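/- **Setting.** Let $d\ge 1$. For a positive definite matrix $Q$ and $\psi:\mathbb R^d\to\mathbb R\cup\{+\infty\}$ put $\psi_{\zeta,Q}(x)=\inf_y\{\psi(y)+\frac1{2\zeta}\|Q^{1/2}(x-y)\|^2\}$, let $\mathrm{prox}_{\zeta\psi,Q}(x)$ be the minimizer, and call $\psi$ $(\rho,Q)$-weakly convex if $\psi+\frac\rho2\|Q^{1/2}\cdot\|^2$ is convex. Let $\psi=f+h$, where $h$ is closed and convex, $\psi$ is bounded below with infimum $\psi^*$, and $f$ is $(\rho,Q)$-weakly convex for some $\rho>0$ and $Q=\mathrm{diag}(p)$, $p_i>0$. Let $\|x-y\|_\infty\le D_\infty$ for all $x,y\in\mathrm{dom}\,h$. Let $P$ be a probability law and $F(x,\xi)$ a jointly measurable function such that on the closed $\mu$-neighbourhood $\{x+\mu w: x\in\mathrm{dom}\,h,\ \|w\|\le1\}$ of $\mathrm{dom}\,h$ (the points at which $F$ is evaluated) $F(\cdot,\xi)$ is $L_F$-Lipschitz for every $\xi$, and $f(x)=\mathbb E_{\xi\sim P}[F(x,\xi)]$ is finite. **Algorithm (proximal ZEMA).** Start with $x_0\in\mathrm{dom}\,h$,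 $m_{-1}=\upsilon_{-1}=0$ and $\hat\upsilon_{-1}=q$, where $0<q_{\min}\le q_i\le q_{\max}$ and $\sqrt{q_i}\ge p_i$ (i.e. $Q\preceq\hat V_{-1}^{1/2}$). For $t=0,\dots,T$ draw independent $\xi_t\sim P$ and $u_t$ uniform on the Euclidean unit sphere, and set (coordinatewise operations) $$g_t=\tfrac d\mu\,[F(x_t+\mu u_t,\xi_t)-F(x_t,\xi_t)]\,u_t,\qquad m_t=\beta_{1,t}m_{t-1}+(1-\beta_{1,t})g_t,\qquad \upsilon_t=\beta_2\upsilon_{t-1}+(1-\beta_2)g_t^2,$$ $$\hat\upsilon_t=\beta_3\hat\upsilon_{t-1}+(1-\beta_3)\max(\hat\upsilon_{t-1},\upsilon_t),\qquad \hat V_t=\mathrm{diag}(\hat\upsilon_t),\qquad x_{t+1}=\mathrm{prox}_{\alpha_th,\hat V_t^{1/2}}\big(x_t-\alpha_t\hat V_t^{-1/2}m_t\big).$$ The output index $t^*$ is independent of all samples, with $\mathbb P(t^*=t)=\alpha_t/\sum_{s=0}^T\alpha_s$ for $0\le t\le T$. **Claim.** Let $\beta_1,\beta_2,\beta_3\in[0,1)$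 with $\beta_1/\sqrt{\beta_2}<1$, $\pi\in(0,1)$, and for $0\le t\le T$ $$\beta_{1,t}=\beta_1\pi^{t-1},\qquad \mu=\frac d{\sqrt{T+1}},\qquad \alpha_t=\frac\alpha{\sqrt{T+1}},\qquad 0<\alpha\le\frac1{2\rho}.$$ Let $\Delta$ be such that $\psi_{1/(2\rho),\hat V_{-1}^{1/2}}(x_0)-\psi^*\le\Delta$. Then $\psi_{1/(2\rho),\hat V_t^{1/2}}$ is differentiable at $x_t$ for all $0\le t\le T$, and there are constants $K$, depending only on $(\rho,\alpha,\beta_1,\beta_2,\beta_3,\pi,L_F,D_\infty,q_{\min},q_{\max},\Delta)$, and $C_d$, depending only on these numbers and on $d$, such that for every $T\ge1$ and every such problem in dimension $d$ $$\mathbb E\Big[\big\|\nabla\psi_{1/(2\rho),\hat V_{t^*}^{1/2}}(x_{t^*})\big\|^2\Big]\le C_d\,\frac{d^2}{\sqrt T},\qquad \mathbb E\Big[\big\|\hat V_{t^*}^{-1/4}\,\nabla\psi_{1/(2\rho),\hat V_{t^*}^{1/2}}(x_{t^*})\big\|^2\Big]\le K\,\frac{d^2}{\sqrt T}$$ (both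 random variables being integrable). -/

import Mathlib

open MeasureTheory ProbabilityTheory Set

universe u v

namespace Zema

/-! ### Extended-real-valued functions, scaled norms, proximal maps and Moreau envelopes -/

/-- Effective domain of a function with values in `ℝ ∪ {+∞}`. -/
def effDom {d : ℕ} (ψ : EuclideanSpace ℝ (Fin d) → EReal) : Set (EuclideanSpace ℝ (Fin d)) :=
  {x | ψ x < ⊤}

/-- Convexity of a function with values in `ℝ ∪ {+∞}`. -/
def IsConvexFun {d : ℕ} (ψ : EuclideanSpace ℝ (Fin d) → EReal) : Prop :=
  ∀ x y : EuclideanSpace ℝ (Fin d), ∀ t : ℝ, 0 ≤ t → t ≤ 1 →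
    ψ (t • x + (1 - t) • y) ≤ (t : EReal) * ψ x + ((1 - t : ℝ) : EReal) * ψ y

/-- A function is closed if its epigraph is a closed set. -/
def IsClosedFun {d : ℕ} (ψ : EuclideanSpace ℝ (Fin d) → EReal) : Prop :=
  IsClosed {z : EuclideanSpace ℝ (Fin d) × ℝ | ψ z.1 ≤ (z.2 : EReal)}

/-- The squared scaled norm `‖Q^{1/2} x‖² = xᵀ Q x`, for `Q` symmetric positive definite. -/
noncomputable def scaledNormSq {d : ℕ} (Q : Matrix (Fin d) (Fin d) ℝ)
    (x : EuclideanSpace ℝ (Fin d)) : ℝ :=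
  x.ofLp ⬝ᵥ Q.mulVec x.ofLp

/-- `(ρ, Q)`-weak convexity: `x ↦ ψ x + (ρ/2) ‖Q^{1/2} x‖²` is convex. -/
def IsWeaklyConvex {d : ℕ} (ρ : ℝ) (Q : Matrix (Fin d) (Fin d) ℝ)
    (ψ : EuclideanSpace ℝ (Fin d) → EReal) : Prop :=
  IsConvexFun fun x => ψ x + ((ρ / 2 * scaledNormSq Q x : ℝ) : EReal)

/-- The objective `y ↦ ψ y + (1/(2ζ)) ‖Q^{1/2} (x - y)‖²` of the scaled proximal problem at `x`. -/
noncomputable def proxObjective {d : ℕ} (ψ : EuclideanSpace ℝ (Fin d) → EReal) (ζ : ℝ)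
    (Q : Matrix (Fin d) (Fin d) ℝ) (x y : EuclideanSpace ℝ (Fin d)) : EReal :=
  ψ y + ((1 / (2 * ζ) * scaledNormSq Q (x - y) : ℝ) : EReal)

/-- The scaled Moreau envelope `ψ_{ζ,Q}`. -/
noncomputable def moreauEnvelope {d : ℕ} (ψ : EuclideanSpace ℝ (Fin d) → EReal) (ζ : ℝ)
    (Q : Matrix (Fin d) (Fin d) ℝ) (x : EuclideanSpace ℝ (Fin d)) : EReal :=
  ⨅ y, proxObjective ψ ζ Q x y

/-- The scaled Moreau envelope as a real-valued function. -/
noncomputable def realEnvelope {d : ℕ} (ψ : EuclideanSpace ℝ (Fin d) → EReal) (ζ : ℝ)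
    (Q : Matrix (Fin d) (Fin d) ℝ) (x : EuclideanSpace ℝ (Fin d)) : ℝ :=
  (moreauEnvelope ψ ζ Q x).toReal

/-- The scaled proximal map `prox_{ζψ,Q}`: the minimizer of the proximal problem (chosen
arbitrarily if there is none or more than one, which does not happen when `ψ` is proper closed
convex, `ζ > 0` and `Q` is positive definite). -/
noncomputable def prox {d : ℕ} (ψ : EuclideanSpace ℝ (Fin d) → EReal) (ζ : ℝ)
    (Q : Matrix (Fin d) (Fin d) ℝ) (x : EuclideanSpace ℝ (Fin d)) : EuclideanSpace ℝ (Fin d) :=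
  Classical.epsilon fun z => ∀ y, proxObjective ψ ζ Q x z ≤ proxObjective ψ ζ Q x y

/-- The diagonal matrix `V^{1/2}` for `V = diag v`. -/
noncomputable def sqrtDiag {d : ℕ} (v : Fin d → ℝ) : Matrix (Fin d) (Fin d) ℝ :=
  Matrix.diagonal fun i => √(v i)

/-! ### The algorithm -/

/-- The zeroth-order gradient estimator `(d/μ) [F(x + μu, ξ) - F(x, ξ)] u`. -/
noncomputable def gradEstimator {d : ℕ} {Ξ : Type u} (F : EuclideanSpace ℝ (Fin d) → Ξ → ℝ)
    (μ : ℝ) (x : EuclideanSpace ℝ (Fin d)) (ξ : Ξ) (w : EuclideanSpace ℝ (Fin d)) :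
    EuclideanSpace ℝ (Fin d) :=
  ((d : ℝ) / μ * (F (x + μ • w) ξ - F x ξ)) • w

/-- State at the beginning of iteration `t`: the iterate `x_t` and the averages
`m_{t-1}`, `υ_{t-1}`, `υ̂_{t-1}`. -/
structure State (d : ℕ) where
  x : EuclideanSpace ℝ (Fin d)
  m : EuclideanSpace ℝ (Fin d)
  v : Fin d → ℝ
  vhat : Fin d → ℝ

/-- One iteration with stepsize `a`, momentum parameter `b₁`, and sample `(ξ, w)`. -/
noncomputable def step {d : ℕ} {Ξ : Type u} (F : EuclideanSpace ℝ (Fin d) → Ξ → ℝ)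
    (h : EuclideanSpace ℝ (Fin d) → EReal) (β₂ β₃ μ a b₁ : ℝ) (ξ : Ξ)
    (w : EuclideanSpace ℝ (Fin d)) (s : State d) : State d :=
  let g := gradEstimator F μ s.x ξ w
  let m := b₁ • s.m + (1 - b₁) • g
  let v : Fin d → ℝ := fun i => β₂ * s.v i + (1 - β₂) * g i ^ 2
  let vhat : Fin d → ℝ := fun i => β₃ * s.vhat i + (1 - β₃) * max (s.vhat i) (v i)
  { x := prox h a (sqrtDiag vhat) (s.x - a • WithLp.toLp 2 (fun i => m i / √(vhat i)))
    m := m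
    v := v
    vhat := vhat }

/-- The run of the algorithm along the samples `(ξ t, w t)`, started at `x₀` with
`m_{-1} = υ_{-1} = 0` and `υ̂_{-1} = q`; `run … t` is the state before iteration `t`. -/
noncomputable def run {d : ℕ} {Ξ : Type u} (F : EuclideanSpace ℝ (Fin d) → Ξ → ℝ)
    (h : EuclideanSpace ℝ (Fin d) → EReal) (β₂ β₃ μ : ℝ) (a b₁ : ℕ → ℝ)
    (x₀ : EuclideanSpace ℝ (Fin d)) (q : Fin d → ℝ)
    (ξ : ℕ → Ξ) (w : ℕ → EuclideanSpace ℝ (Fin d)) : ℕ → State d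
  | 0 => { x := x₀, m := 0, v := 0, vhat := q }
  | t + 1 => step F h β₂ β₃ μ (a t) (b₁ t) (ξ t) (w t) (run F h β₂ β₃ μ a b₁ x₀ q ξ w t)

/-! ### Assumptions on the problem and on the random samples -/

/-- The uniform distribution on the Euclidean unit sphere, as a measure on the whole space. -/
noncomputable def sphereUniform (d : ℕ) : Measure (EuclideanSpace ℝ (Fin d)) :=
  (cond (volume : Measure (EuclideanSpace ℝ (Fin d))).toSphere univ).map Subtype.val

/-- The closed `μ`-neighbourhood of `dom h`, i.e. all points `x + μ w` with `x ∈ dom h`,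
`‖w‖ ≤ 1`; it contains every point at which the algorithm evaluates `F`. -/
def evalRegion {d : ℕ} (h : EuclideanSpace ℝ (Fin d) → EReal) (μ : ℝ) :
    Set (EuclideanSpace ℝ (Fin d)) :=
  {z | ∃ x ∈ effDom h, ‖z - x‖ ≤ μ}

/-- Assumptions on the composite problem `min f + h`, where `f x = E[F(x, ξ)]` and `ξ ∼ P`. -/
structure IsProblem {d : ℕ} {Ξ : Type u} [MeasurableSpace Ξ] (P : Measure Ξ)
    (F : EuclideanSpace ℝ (Fin d) → Ξ → ℝ) (f h : EuclideanSpace ℝ (Fin d) → EReal)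
    (ρ : ℝ) (p : Fin d → ℝ) (L D μ : ℝ) : Prop where
  f_ne_bot : ∀ x, f x ≠ ⊥
  h_ne_bot : ∀ x, h x ≠ ⊥
  p_pos : ∀ i, 0 < p i
  f_weaklyConvex : IsWeaklyConvex ρ (Matrix.diagonal p) f
  h_closed : IsClosedFun h
  h_convex : IsConvexFun h
  bddBelow : ∃ c : ℝ, ∀ x, (c : EReal) ≤ f x + h x
  dom_bounded : ∀ x ∈ effDom h, ∀ y ∈ effDom h, ∀ i, |x i - y i| ≤ D
  F_measurable : Measurable (Function.uncurry F)
  F_integrable : ∀ x ∈ evalRegion h μ, Integrable (F x) P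
  f_eq : ∀ x ∈ evalRegion h μ, f x = ((∫ s, F x s ∂P : ℝ) : EReal)
  F_lipschitz : ∀ s, ∀ x ∈ evalRegion h μ, ∀ y ∈ evalRegion h μ,
    |F x s - F y s| ≤ L * ‖x - y‖

/-- The pairs `(ξ_t, w_t)` are i.i.d., `ξ_t ∼ P` and `w_t` uniform on the unit sphere are
independent, and the output index `τ` is independent of all of them, with
`Pr(τ = t) = a_t / ∑_{s ≤ T} a_s` for `t ≤ T`. -/
structure IsSampling {d : ℕ} {Ξ : Type u} [MeasurableSpace Ξ] (P : Measure Ξ)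
    {Ω : Type v} [MeasurableSpace Ω] (Pr : Measure Ω) (a : ℕ → ℝ) (T : ℕ)
    (ξ : ℕ → Ω → Ξ) (w : ℕ → Ω → EuclideanSpace ℝ (Fin d)) (τ : Ω → ℕ) : Prop where
  measurable_ξ : ∀ t, Measurable (ξ t)
  measurable_w : ∀ t, Measurable (w t)
  measurable_τ : Measurable τ
  law : ∀ t, Pr.map (fun ω => (ξ t ω, w t ω)) = P.prod (sphereUniform d)
  indep : iIndepFun (fun t ω => (ξ t ω, w t ω)) Pr
  law_τ : ∀ t ≤ T, Pr {ω | τ ω = t} = ENNReal.ofReal (a t / ∑ s ∈ Finset.range (T + 1), a s)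
  indep_τ : IndepFun τ (fun ω t => (ξ t ω, w t ω)) Pr

/-- The gradient at `x_t` of the scaled Moreau envelope `ψ_{ζ, V̂_t^{1/2}}`, along a run `S`. -/
noncomputable def envelopeGrad {d : ℕ} (ψ : EuclideanSpace ℝ (Fin d) → EReal) (ζ : ℝ)
    (S : ℕ → State d) (t : ℕ) : EuclideanSpace ℝ (Fin d) :=
  gradient (realEnvelope ψ ζ (sqrtDiag (S (t + 1)).vhat)) (S t).x

end Zema

/-! The Moreau envelope of ψ = f + h serves as a Lyapunov function. Let W_t be the diagonal of
V̂_{t-1}^{1/2} (`runWeight` at t) and y_t the proximal point of ψ at x_t in the metric W_t. The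
envelope has gradient 2ρ W (x - prox) (`hasGradientAt_realEnvelope`), so both claims reduce to
bounding the average over t of the squared proximal displacement at x_t in the metric W_{t+1}.

In one iteration (`realEnvelope_step_le`), y_t is the common test point: it competes in the envelope
at x_{t+1} and in the proximal problem of h, while x_{t+1} competes in the proximal problem of ψ at
x_t. Quadratic growth around minimizers (`prox_growth`) then yields a decrease of order a_t ‖x_t -
y_t‖², up to four errors. The metric only increases and each weight stays below √qmax + dL, so on a
bounded domain its changes telescope. The momentum errors are summable, because β_{1,t} is
geometric. The a_t² terms sum to a constant. The last error is the failure of the first-order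
convexity inequality for the random estimate g_t (`convexityGap`).

For that error, (x_t, y_t) depends only on the samples before t, so sample t may be integrated out
first. The mean of g_t is the gradient of the average of f over a ball of radius μ. This average
inherits weak convexity and differs from f by at most Lμ, so the expected gap is at most 2Lμ
(`integral_inner_gradEstimator_le`). That derivatives of ball averages are sphere averages is needed
for merely continuous functions; it follows from polar coordinates about a point other than the
centre (`hasDerivAt_integral_ball_translate`).

The gradient in the claim uses W_{t+1}, which depends on sample t; `wnormSq_sub_prox_le` passes from
W_t to W_{t+1} at the price of another telescoping term. The factor d² comes from the trace bound
d(√qmax + dL) and from ‖m_t‖² = O(d²L²). -/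

namespace Zema

open Filter Topology

/-! ### Weighted square norms -/

/-- The weighted square norm `∑ wᵢ xᵢ²`. -/
noncomputable def wnormSq {d : ℕ} (w : Fin d → ℝ) (x : EuclideanSpace ℝ (Fin d)) : ℝ :=
  ∑ i, w i * x i ^ 2

section wnormSq

variable {d : ℕ} {w w' : Fin d → ℝ} {x y z : EuclideanSpace ℝ (Fin d)}

lemma scaledNormSq_diagonal (w : Fin d → ℝ) (x : EuclideanSpace ℝ (Fin d)) :
    scaledNormSq (Matrix.diagonal w) x = wnormSq w x := by
  simp only [scaledNormSq, wnormSq, dotProduct, Matrix.mulVec_diagonal]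
  exact Finset.sum_congr rfl fun i _ => by ring

lemma wnormSq_nonneg (hw : ∀ i, 0 ≤ w i) (x : EuclideanSpace ℝ (Fin d)) : 0 ≤ wnormSq w x :=
  Finset.sum_nonneg fun i _ => mul_nonneg (hw i) (sq_nonneg _)

lemma wnormSq_mono (h : ∀ i, w i ≤ w' i) (x : EuclideanSpace ℝ (Fin d)) :
    wnormSq w x ≤ wnormSq w' x :=
  Finset.sum_le_sum fun i _ => mul_le_mul_of_nonneg_right (h i) (sq_nonneg _)

lemma wnormSq_sub_comm (w : Fin d → ℝ) (x y : EuclideanSpace ℝ (Fin d)) :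
    wnormSq w (x - y) = wnormSq w (y - x) := by
  simp only [wnormSq, PiLp.sub_apply]
  exact Finset.sum_congr rfl fun i _ => by ring

lemma continuous_wnormSq (w : Fin d → ℝ) : Continuous (wnormSq w) := by
  unfold wnormSq
  fun_prop

/-- The exact convexity defect of the quadratic; its last term is the strong convexity that
outweighs the weak convexity of ψ. -/
lemma wnormSq_sub_convexCombo (w : Fin d → ℝ) (x y z : EuclideanSpace ℝ (Fin d)) (t : ℝ) :
    wnormSq w (x - (t • y + (1 - t) • z)) =
      t * wnormSq w (x - y) + (1 - t) * wnormSq w (x - z) - t * (1 - t) * wnormSq w (y - z) := by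
  simp only [wnormSq, PiLp.sub_apply, PiLp.add_apply, PiLp.smul_apply, smul_eq_mul,
    Finset.mul_sum, ← Finset.sum_add_distrib, ← Finset.sum_sub_distrib]
  exact Finset.sum_congr rfl fun i _ => by ring

lemma wnormSq_convexCombo (w : Fin d → ℝ) (y z : EuclideanSpace ℝ (Fin d)) (t : ℝ) :
    wnormSq w (t • y + (1 - t) • z) =
      t * wnormSq w y + (1 - t) * wnormSq w z - t * (1 - t) * wnormSq w (y - z) := by
  simp only [wnormSq, PiLp.sub_apply, PiLp.add_apply, PiLp.smul_apply, smul_eq_mul,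
    Finset.mul_sum, ← Finset.sum_add_distrib, ← Finset.sum_sub_distrib]
  exact Finset.sum_congr rfl fun i _ => by ring

lemma wnormSq_le_of_abs_le {D : ℝ} (hw : ∀ i, 0 ≤ w i) (h : ∀ i, |x i - y i| ≤ D) :
    wnormSq w (x - y) ≤ D ^ 2 * ∑ i, w i := by
  rw [Finset.mul_sum]
  refine Finset.sum_le_sum fun i _ => ?_
  rw [PiLp.sub_apply, mul_comm]
  exact mul_le_mul_of_nonneg_right (sq_le_sq' (by linarith [abs_le.1 (h i)])
    (le_of_abs_le (h i))) (hw i)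

lemma mul_norm_sq_le_wnormSq {b : ℝ} (h : ∀ i, b ≤ w i) (x : EuclideanSpace ℝ (Fin d)) :
    b * ‖x‖ ^ 2 ≤ wnormSq w x := by
  rw [EuclideanSpace.real_norm_sq_eq, Finset.mul_sum]
  exact Finset.sum_le_sum fun i _ => mul_le_mul_of_nonneg_right (h i) (sq_nonneg _)

lemma norm_sub_sq_le_of_abs_le {D : ℝ} (h : ∀ i, |x i - y i| ≤ D) :
    ‖x - y‖ ^ 2 ≤ d * D ^ 2 := by
  have := wnormSq_le_of_abs_le (w := fun _ => 1) (fun _ => zero_le_one) h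
  have h2 := mul_norm_sq_le_wnormSq (w := fun _ => 1) (b := 1) (fun _ => le_rfl) (x - y)
  simp only [Finset.sum_const, Finset.card_univ, Fintype.card_fin, nsmul_eq_mul] at this
  linarith

end wnormSq

/-! ### Proximal maps and Moreau envelopes of weakly convex functions with bounded domain -/

/-- Proper lower semicontinuous functions with bounded domain that become convex after adding
`κ ∑ pᵢ xᵢ²`. -/
structure ProxRegular {d : ℕ} (φ : EuclideanSpace ℝ (Fin d) → EReal) (κ D : ℝ)
    (p : Fin d → ℝ) : Prop where
  lsc : LowerSemicontinuous φ
  ne_bot : ∀ x, φ x ≠ ⊥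
  nonempty : (effDom φ).Nonempty
  bounded : ∀ x ∈ effDom φ, ∀ y ∈ effDom φ, ∀ i, |x i - y i| ≤ D
  -- The quadratic is moved to the right as a defect, and only points of the domain occur, so the
  -- values can be handled in ℝ.
  convex : ∀ x ∈ effDom φ, ∀ y ∈ effDom φ, ∀ t : ℝ, 0 ≤ t → t ≤ 1 →
    φ (t • x + (1 - t) • y) ≤ ((t * (φ x).toReal + (1 - t) * (φ y).toReal
      + κ * (t * (1 - t) * wnormSq p (x - y)) : ℝ) : EReal)

namespace ProxRegular

variable {d : ℕ} {φ : EuclideanSpace ℝ (Fin d) → EReal} {κ D ζ : ℝ} {p w w' : Fin d → ℝ}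
  {x x' y : EuclideanSpace ℝ (Fin d)}

lemma coe_toReal (hφ : ProxRegular φ κ D p) (hx : x ∈ effDom φ) : ((φ x).toReal : EReal) = φ x :=
  EReal.coe_toReal (ne_of_lt hx) (hφ.ne_bot x)

lemma isCompact_closure (hφ : ProxRegular φ κ D p) : IsCompact (closure (effDom φ)) := by
  refine Bornology.IsBounded.isCompact_closure ?_
  obtain ⟨x, hx⟩ := hφ.nonempty
  refine (Metric.isBounded_iff_subset_closedBall x).2 ⟨√(d * D ^ 2), fun y hy => ?_⟩
  rw [Metric.mem_closedBall, dist_eq_norm]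
  exact Real.le_sqrt_of_sq_le (norm_sub_sq_le_of_abs_le (hφ.bounded y hy x hx))

lemma proxObjective_diagonal (hφ : ProxRegular φ κ D p) (hy : y ∈ effDom φ) :
    proxObjective φ ζ (Matrix.diagonal w) x y =
      (((φ y).toReal + 1 / (2 * ζ) * wnormSq w (x - y) : ℝ) : EReal) := by
  rw [proxObjective, scaledNormSq_diagonal, EReal.coe_add, hφ.coe_toReal hy]

lemma proxObjective_of_notMem {Q : Matrix (Fin d) (Fin d) ℝ} (hy : y ∉ effDom φ) :
    proxObjective φ ζ Q x y = ⊤ := by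
  have : φ y = ⊤ := by simpa [effDom] using hy
  rw [proxObjective, this, EReal.top_add_coe]

/-- Lower semicontinuity and compactness suffice; convexity plays no role. The domain need not be
closed, so the minimum is taken over its closure; off the domain the objective is `⊤`. -/
lemma exists_forall_proxObjective_le (hφ : ProxRegular φ κ D p)
    (x : EuclideanSpace ℝ (Fin d)) :
    ∃ z, ∀ y, proxObjective φ ζ (Matrix.diagonal w) x z ≤
      proxObjective φ ζ (Matrix.diagonal w) x y := by
  have hl : LowerSemicontinuous (proxObjective φ ζ (Matrix.diagonal w) x) := by
    unfold proxObjective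
    simp only [scaledNormSq_diagonal]
    refine hφ.lsc.add' (Continuous.lowerSemicontinuous ?_) fun y =>
      EReal.continuousAt_add (Or.inr (EReal.coe_ne_bot _)) (Or.inr (EReal.coe_ne_top _))
    have := continuous_wnormSq w
    exact continuous_coe_real_ereal.comp (by fun_prop)
  obtain ⟨z, -, hz⟩ := (hl.lowerSemicontinuousOn _).exists_isMinOn
    hφ.nonempty.closure hφ.isCompact_closure
  refine ⟨z, fun y => ?_⟩
  by_cases hy : y ∈ effDom φ
  · exact hz (subset_closure hy)
  · rw [proxObjective_of_notMem hy]
    exact le_top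

lemma prox_le (hφ : ProxRegular φ κ D p) (x y : EuclideanSpace ℝ (Fin d)) :
    proxObjective φ ζ (Matrix.diagonal w) x (prox φ ζ (Matrix.diagonal w) x) ≤
      proxObjective φ ζ (Matrix.diagonal w) x y :=
  Classical.epsilon_spec (hφ.exists_forall_proxObjective_le x) y

lemma prox_mem (hφ : ProxRegular φ κ D p) (x : EuclideanSpace ℝ (Fin d)) :
    prox φ ζ (Matrix.diagonal w) x ∈ effDom φ := by
  by_contra h
  obtain ⟨y, hy⟩ := hφ.nonempty
  have := hφ.prox_le (ζ := ζ) (w := w) x y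
  rw [proxObjective_of_notMem h, hφ.proxObjective_diagonal hy] at this
  exact EReal.coe_ne_top _ (top_le_iff.1 this)

lemma realEnvelope_eq (hφ : ProxRegular φ κ D p) (x : EuclideanSpace ℝ (Fin d)) :
    realEnvelope φ ζ (Matrix.diagonal w) x = (φ (prox φ ζ (Matrix.diagonal w) x)).toReal +
      1 / (2 * ζ) * wnormSq w (x - prox φ ζ (Matrix.diagonal w) x) := by
  rw [realEnvelope, moreauEnvelope,
    le_antisymm (iInf_le _ (prox φ ζ (Matrix.diagonal w) x)) (le_iInf (hφ.prox_le x)),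
    hφ.proxObjective_diagonal (hφ.prox_mem x), EReal.toReal_coe]

lemma coe_realEnvelope (hφ : ProxRegular φ κ D p) (x : EuclideanSpace ℝ (Fin d)) :
    (realEnvelope φ ζ (Matrix.diagonal w) x : EReal) = moreauEnvelope φ ζ (Matrix.diagonal w) x := by
  rw [realEnvelope, moreauEnvelope,
    le_antisymm (iInf_le _ (prox φ ζ (Matrix.diagonal w) x)) (le_iInf (hφ.prox_le x)),
    hφ.proxObjective_diagonal (hφ.prox_mem x), EReal.toReal_coe]

lemma realEnvelope_le (hφ : ProxRegular φ κ D p) (x : EuclideanSpace ℝ (Fin d))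
    (hy : y ∈ effDom φ) :
    realEnvelope φ ζ (Matrix.diagonal w) x ≤
      (φ y).toReal + 1 / (2 * ζ) * wnormSq w (x - y) := by
  rw [← EReal.coe_le_coe_iff, hφ.coe_realEnvelope, ← hφ.proxObjective_diagonal hy]
  exact iInf_le _ y

/-- The proximal objective grows quadratically around the proximal point. -/
lemma prox_growth (hφ : ProxRegular φ κ D p) (hκ : 0 ≤ κ) (hpw : ∀ i, p i ≤ w i)
    (x : EuclideanSpace ℝ (Fin d)) (hy : y ∈ effDom φ) :
    (φ (prox φ ζ (Matrix.diagonal w) x)).toReal +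
        1 / (2 * ζ) * wnormSq w (x - prox φ ζ (Matrix.diagonal w) x) +
        (1 / (2 * ζ) - κ) * wnormSq w (y - prox φ ζ (Matrix.diagonal w) x) ≤
      (φ y).toReal + 1 / (2 * ζ) * wnormSq w (x - y) := by
  set z := prox φ ζ (Matrix.diagonal w) x with hz
  have hzm : z ∈ effDom φ := hφ.prox_mem x
  set A := (φ z).toReal + 1 / (2 * ζ) * wnormSq w (x - z) with hA
  set B := (φ y).toReal + 1 / (2 * ζ) * wnormSq w (x - y) with hB
  set G := (1 / (2 * ζ) - κ) * wnormSq w (y - z) with hG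
  -- The minimizer z is compared with t y + (1 - t) z. After division by t the defect still carries
  -- a factor 1 - t, which disappears as t → 0.
  have key : ∀ t : ℝ, 0 < t → t ≤ 1 → A + G - B ≤ t * G := by
    intro t ht ht1
    have hc := hφ.convex y hy z hzm t ht.le ht1
    have hm : t • y + (1 - t) • z ∈ effDom φ := lt_of_le_of_lt hc (EReal.coe_lt_top _)
    rw [← hφ.coe_toReal hm, EReal.coe_le_coe_iff] at hc
    have h1 := hφ.prox_le (ζ := ζ) (w := w) x (t • y + (1 - t) • z)
    rw [← hz, hφ.proxObjective_diagonal hzm, hφ.proxObjective_diagonal hm, EReal.coe_le_coe_iff,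
      wnormSq_sub_convexCombo] at h1
    have h2 : κ * (t * (1 - t) * wnormSq p (y - z)) ≤ κ * (t * (1 - t) * wnormSq w (y - z)) :=
      mul_le_mul_of_nonneg_left (mul_le_mul_of_nonneg_left (wnormSq_mono hpw _)
        (mul_nonneg ht.le (by linarith))) hκ
    have h3 : t * (A + G - B) ≤ t * (t * G) := by
      rw [hA, hB, hG]
      linarith
    exact le_of_mul_le_mul_left h3 ht
  have : A + G - B ≤ 0 := by
    have ht : Tendsto (fun t : ℝ => t * G) (𝓝[>] 0) (𝓝 0) := by
      have : Tendsto (fun t : ℝ => t * G) (𝓝 0) (𝓝 (0 * G)) := tendsto_id.mul_const G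
      rw [zero_mul] at this
      exact this.mono_left nhdsWithin_le_nhds
    refine ge_of_tendsto ht ?_
    filter_upwards [Ioc_mem_nhdsGT (zero_lt_one' ℝ)] with t ht
    exact key t ht.1 ht.2
  linarith

/-- Each proximal point is tested in the other's problem and the two growth inequalities are added.
The values of φ cancel, and what remains is linear in the changes of weights and centre. One of the
two growth terms is discarded. -/
lemma prox_stability (hφ : ProxRegular φ κ D p) (hκ : 0 ≤ κ) (hc : κ ≤ 1 / (2 * ζ))
    (hw' : ∀ i, 0 ≤ w' i) (hpw : ∀ i, p i ≤ w i) (hpw' : ∀ i, p i ≤ w' i)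
    (x x' : EuclideanSpace ℝ (Fin d)) :
    (1 / (2 * ζ) - κ) * wnormSq w
        (prox φ ζ (Matrix.diagonal w) x - prox φ ζ (Matrix.diagonal w') x') ≤
      1 / (2 * ζ) * ∑ i, D * (|w i - w' i| * (2 * |x i - prox φ ζ (Matrix.diagonal w) x i| + D)
        + w' i * (2 * |x i - x' i|)) := by
  set z := prox φ ζ (Matrix.diagonal w) x with hz
  set z' := prox φ ζ (Matrix.diagonal w') x' with hz'
  have hzm : z ∈ effDom φ := hφ.prox_mem x
  have hzm' : z' ∈ effDom φ := hφ.prox_mem x'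
  have h1 := hφ.prox_growth (ζ := ζ) hκ hpw x hzm'
  have h2 := hφ.prox_growth (ζ := ζ) hκ hpw' x' hzm
  rw [← hz, wnormSq_sub_comm w z' z] at h1
  rw [← hz'] at h2
  have h3 : 0 ≤ (1 / (2 * ζ) - κ) * wnormSq w' (z - z') :=
    mul_nonneg (sub_nonneg.2 hc) (wnormSq_nonneg hw' _)
  have h4 : (wnormSq w (x - z') - wnormSq w (x - z)) +
      (wnormSq w' (x' - z) - wnormSq w' (x' - z')) ≤
      ∑ i, D * (|w i - w' i| * (2 * |x i - z i| + D) + w' i * (2 * |x i - x' i|)) := by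
    simp only [wnormSq, ← Finset.sum_sub_distrib, ← Finset.sum_add_distrib, PiLp.sub_apply]
    refine Finset.sum_le_sum fun i _ => ?_
    have hD := hφ.bounded z hzm z' hzm' i
    have e : w i * (x i - z' i) ^ 2 - w i * (x i - z i) ^ 2 + (w' i * (x' i - z i) ^ 2 -
        w' i * (x' i - z' i) ^ 2) = (z i - z' i) * ((w i - w' i) *
          (2 * (x i - z i) + (z i - z' i)) + w' i * (2 * (x i - x' i))) := by ring
    rw [e]
    refine (le_abs_self _).trans ?_
    rw [abs_mul]
    refine mul_le_mul hD ?_ (abs_nonneg _) ((abs_nonneg _).trans hD)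
    refine (abs_add_le _ _).trans (add_le_add ?_ ?_)
    · rw [abs_mul]
      refine mul_le_mul_of_nonneg_left ((abs_add_le _ _).trans (add_le_add ?_ hD)) (abs_nonneg _)
      rw [abs_mul, abs_two]
    · rw [abs_mul, abs_mul, abs_two, abs_of_nonneg (hw' i)]
  have h5 := mul_le_mul_of_nonneg_left h4 (hκ.trans hc)
  linarith

/-- Joint continuity in metric and centre gives measurability of the iterates; continuity in the
centre alone gives differentiability of the envelope. -/
lemma continuous_prox (hφ : ProxRegular φ κ D p) (hκ : 0 ≤ κ) (hc : κ < 1 / (2 * ζ)) :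
    Continuous fun q : {w : Fin d → ℝ // ∀ i, 0 < w i ∧ p i ≤ w i} × EuclideanSpace ℝ (Fin d) =>
      prox φ ζ (Matrix.diagonal q.1.1) q.2 := by
  rw [continuous_iff_continuousAt]
  rintro ⟨w, x⟩
  set z := prox φ ζ (Matrix.diagonal w.1) x with hz
  -- The bound of `prox_stability` solved for the squared distance; it is continuous and vanishes at
  -- the base point.
  set R : {w : Fin d → ℝ // ∀ i, 0 < w i ∧ p i ≤ w i} × EuclideanSpace ℝ (Fin d) → ℝ :=
    fun q => (1 / (2 * ζ) * ∑ i, D * (|w.1 i - q.1.1 i| * (2 * |x i - z i| + D)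
      + q.1.1 i * (2 * |x i - q.2 i|))) / (1 / (2 * ζ) - κ) with hR
  have hRc : Continuous R := by
    rw [hR]
    refine Continuous.div_const (continuous_const.mul (continuous_finsetSum _ fun i _ => ?_)) _
    have h1 : Continuous fun q : {w : Fin d → ℝ // ∀ i, 0 < w i ∧ p i ≤ w i} ×
        EuclideanSpace ℝ (Fin d) => q.1.1 i :=
      (continuous_apply i).comp (continuous_subtype_val.comp continuous_fst)
    fun_prop
  have hR0 : R (w, x) = 0 := by simp [hR]
  have hRt : Tendsto R (𝓝 (w, x)) (𝓝 0) := by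
    have := hRc.tendsto (w, x)
    rwa [hR0] at this
  have key : Tendsto (fun q : {w : Fin d → ℝ // ∀ i, 0 < w i ∧ p i ≤ w i} ×
      EuclideanSpace ℝ (Fin d) => (prox φ ζ (Matrix.diagonal q.1.1) q.2).ofLp)
      (𝓝 (w, x)) (𝓝 z.ofLp) := by
    rw [tendsto_pi_nhds]
    intro i
    rw [tendsto_iff_norm_sub_tendsto_zero]
    have hwi := (w.2 i).1
    have hs : Tendsto (fun q => √(R q / w.1 i)) (𝓝 (w, x)) (𝓝 0) := by
      have := (hRt.div_const (w.1 i)).sqrt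
      simpa using this
    refine squeeze_zero (fun _ => norm_nonneg _) (fun q => ?_) hs
    refine Real.le_sqrt_of_sq_le ?_
    rw [le_div_iff₀ hwi, hR, le_div_iff₀ (sub_pos.2 hc)]
    refine le_trans ?_ (hφ.prox_stability hκ hc.le
      (fun i => (q.1.2 i).1.le) (fun i => (w.2 i).2) (fun i => (q.1.2 i).2) x q.2)
    rw [mul_comm]
    refine mul_le_mul_of_nonneg_left ?_ (sub_pos.2 hc).le
    refine le_trans (le_of_eq ?_) (Finset.single_le_sum (f := fun i => w.1 i *
      (z - prox φ ζ (Matrix.diagonal q.1.1) q.2) i ^ 2)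
      (fun j _ => mul_nonneg (w.2 j).1.le (sq_nonneg _)) (Finset.mem_univ i))
    simp only [PiLp.sub_apply, Real.norm_eq_abs, sq_abs]
    ring
  exact ((PiLp.continuous_toLp 2 (fun _ : Fin d => ℝ)).tendsto _).comp key

/-- The envelope is an infimum of quadratics in x. Testing at x' with the proximal point of x bounds
its increment from above, and testing at x with that of x' bounds it from below. Both bounds have
linear part g, and continuity of the proximal map makes the remainders o(‖x' - x‖). -/
lemma hasGradientAt_realEnvelope (hφ : ProxRegular φ κ D p) (hκ : 0 ≤ κ)
    (hc : κ < 1 / (2 * ζ)) (hw : ∀ i, 0 < w i) (hpw : ∀ i, p i ≤ w i)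
    (x : EuclideanSpace ℝ (Fin d)) :
    HasGradientAt (realEnvelope φ ζ (Matrix.diagonal w))
      (WithLp.toLp 2 fun i => 1 / ζ * (w i * (x i - prox φ ζ (Matrix.diagonal w) x i))) x := by
  set P := prox φ ζ (Matrix.diagonal w) with hP
  have hcont : Continuous P :=
    (hφ.continuous_prox hκ hc).comp
      (f := fun x => ((⟨w, fun i => ⟨hw i, hpw i⟩⟩ : {w : Fin d → ℝ // ∀ i, 0 < w i ∧ p i ≤ w i}), x))
      (by fun_prop)
  set c := 1 / (2 * ζ) with hcdef
  have hc0 : 0 ≤ c := hκ.trans hc.le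
  set g : EuclideanSpace ℝ (Fin d) :=
    WithLp.toLp 2 fun i => 1 / ζ * (w i * (x i - P x i)) with hg
  -- the error lies between two quantities that are small compared with `x' - x`
  set U : EuclideanSpace ℝ (Fin d) → EuclideanSpace ℝ (Fin d) :=
    fun x' => WithLp.toLp 2 fun i => c * (w i * (2 * (P x i - P x' i) + (x' i - x i))) with hU
  set U' : EuclideanSpace ℝ (Fin d) → EuclideanSpace ℝ (Fin d) :=
    fun x' => WithLp.toLp 2 fun i => c * (w i * (x' i - x i)) with hU'
  have hgc : ∀ i, g i = 2 * c * (w i * (x i - P x i)) := by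
    intro i
    have : 1 / ζ = 2 * c := by rw [hcdef]; ring
    simp only [hg, this]
  have upper : ∀ x', realEnvelope φ ζ (Matrix.diagonal w) x' -
      realEnvelope φ ζ (Matrix.diagonal w) x - inner ℝ g (x' - x) ≤ inner ℝ (U' x') (x' - x) := by
    intro x'
    have h1 := hφ.realEnvelope_le (ζ := ζ) (w := w) x' (hφ.prox_mem (ζ := ζ) (w := w) x)
    have h2 := hφ.realEnvelope_eq (ζ := ζ) (w := w) x
    rw [← hP, ← hcdef] at h1 h2
    have h3 : c * wnormSq w (x' - P x) - c * wnormSq w (x - P x) =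
        inner ℝ g (x' - x) + inner ℝ (U' x') (x' - x) := by
      simp only [wnormSq, PiLp.inner_apply, hgc, hU', PiLp.sub_apply, Finset.mul_sum,
        ← Finset.sum_sub_distrib, ← Finset.sum_add_distrib, RCLike.inner_apply, conj_trivial]
      exact Finset.sum_congr rfl fun i _ => by ring
    linarith
  have lower : ∀ x', inner ℝ (U x') (x' - x) ≤ realEnvelope φ ζ (Matrix.diagonal w) x' -
      realEnvelope φ ζ (Matrix.diagonal w) x - inner ℝ g (x' - x) := by
    intro x'
    have h1 := hφ.realEnvelope_le (ζ := ζ) (w := w) x (hφ.prox_mem (ζ := ζ) (w := w) x')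
    have h2 := hφ.realEnvelope_eq (ζ := ζ) (w := w) x'
    rw [← hP, ← hcdef] at h1 h2
    have h3 : c * wnormSq w (x' - P x') - c * wnormSq w (x - P x') =
        inner ℝ g (x' - x) + inner ℝ (U x') (x' - x) := by
      simp only [wnormSq, PiLp.inner_apply, hgc, hU, PiLp.sub_apply, Finset.mul_sum,
        ← Finset.sum_sub_distrib, ← Finset.sum_add_distrib, RCLike.inner_apply, conj_trivial]
      exact Finset.sum_congr rfl fun i _ => by ring
    linarith
  have hUt : Tendsto (fun x' => ‖U x'‖ + ‖U' x'‖) (𝓝 x) (𝓝 0) := by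
    have hc1 : Continuous fun x' => ‖U x'‖ + ‖U' x'‖ := by
      have a1 : Continuous U := (PiLp.continuous_toLp 2 _).comp (by fun_prop)
      have a2 : Continuous U' := (PiLp.continuous_toLp 2 _).comp (by fun_prop)
      fun_prop
    have h0 : ‖U x‖ + ‖U' x‖ = 0 := by
      have e1 : U x = 0 := by ext i; simp [hU]
      have e2 : U' x = 0 := by ext i; simp [hU']
      simp [e1, e2]
    exact h0 ▸ hc1.tendsto x
  rw [hasGradientAt_iff_isLittleO, Asymptotics.isLittleO_iff]
  intro ε hε
  filter_upwards [hUt.eventually (gt_mem_nhds hε)] with x' hx'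
  have b1 := abs_le.1 (abs_real_inner_le_norm (U x') (x' - x))
  have b2 := abs_le.1 (abs_real_inner_le_norm (U' x') (x' - x))
  have c1 : ‖U x'‖ * ‖x' - x‖ ≤ ε * ‖x' - x‖ :=
    mul_le_mul_of_nonneg_right (by linarith [norm_nonneg (U' x')]) (norm_nonneg _)
  have c2 : ‖U' x'‖ * ‖x' - x‖ ≤ ε * ‖x' - x‖ :=
    mul_le_mul_of_nonneg_right (by linarith [norm_nonneg (U x')]) (norm_nonneg _)
  rw [Real.norm_eq_abs, abs_le]
  constructor
  · linarith [lower x']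
  · linarith [upper x']

end ProxRegular

/-! ### Derivatives of ball averages as sphere averages -/

section Radius

variable {E : Type*} [NormedAddCommGroup E] [InnerProductSpace ℝ E]

open Metric

/-- The distance from the origin, in the direction `u`, of the boundary of the unit ball
centred at `t • v`. -/
noncomputable def radius (v : E) (t : ℝ) (u : E) : ℝ :=
  t * inner ℝ u v + √(1 - t ^ 2 * (‖v‖ ^ 2 - inner ℝ u v ^ 2))

lemma continuous_radius (v : E) (t : ℝ) : Continuous (radius v t) := by
  unfold radius
  fun_prop

lemma radius_zero (v u : E) : radius v 0 u = 1 := by simp [radius]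

lemma abs_inner_le_of_norm_eq_one {u : E} (hu : ‖u‖ = 1) (v : E) : |inner ℝ u v| ≤ ‖v‖ := by
  simpa [hu] using abs_real_inner_le_norm u v

lemma sq_inner_le_of_norm_eq_one {u : E} (hu : ‖u‖ = 1) (v : E) : inner ℝ u v ^ 2 ≤ ‖v‖ ^ 2 := by
  rw [← sq_abs]
  exact pow_le_pow_left₀ (abs_nonneg _) (abs_inner_le_of_norm_eq_one hu v) 2

/-- Linear in t and uniform in u: the domination needed to differentiate under the sphere integral.
-/
lemma abs_radius_sub_one_le {v u : E} {t : ℝ} (hu : ‖u‖ = 1) (ht : |t| * ‖v‖ ≤ 1) :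
    |radius v t u - 1| ≤ 2 * (|t| * ‖v‖) := by
  have h1 := abs_inner_le_of_norm_eq_one hu v
  have h2 := sq_inner_le_of_norm_eq_one hu v
  set s := t ^ 2 * (‖v‖ ^ 2 - inner ℝ u v ^ 2) with hs
  have hs0 : 0 ≤ s := mul_nonneg (sq_nonneg _) (by linarith)
  have hs1 : s ≤ (|t| * ‖v‖) ^ 2 := by
    rw [mul_pow, sq_abs]
    exact mul_le_mul_of_nonneg_left (by linarith [sq_nonneg (inner ℝ u v : ℝ)]) (sq_nonneg _)
  have ht0 : 0 ≤ |t| * ‖v‖ := by positivity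
  have hs2 : (|t| * ‖v‖) ^ 2 ≤ |t| * ‖v‖ := by nlinarith
  have h3 : √(1 - s) ≤ 1 := Real.sqrt_le_one.2 (by linarith)
  have h4 : 1 - s ≤ √(1 - s) := Real.le_sqrt_of_sq_le (by nlinarith)
  have h5 : |t * inner ℝ u v| ≤ |t| * ‖v‖ := by
    rw [abs_mul]
    exact mul_le_mul_of_nonneg_left h1 (abs_nonneg _)
  have h6 := abs_le.1 h5
  rw [radius, ← hs, abs_le]
  constructor <;> linarith

/-- Since |t|‖v‖ < 1 the origin lies inside the translated ball, so every ray from it leaves the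
ball exactly once, at the larger root of a quadratic. -/
lemma smul_mem_ball_iff {v u : E} {t r : ℝ} (hu : ‖u‖ = 1) (ht : |t| * ‖v‖ < 1) (hr : 0 < r) :
    r • u ∈ ball (t • v) 1 ↔ r < radius v t u := by
  have h1 := abs_inner_le_of_norm_eq_one hu v
  have h2 := sq_inner_le_of_norm_eq_one hu v
  set b : ℝ := inner ℝ u v with hb
  have e : ‖r • u - t • v‖ ^ 2 = (r - t * b) ^ 2 + t ^ 2 * (‖v‖ ^ 2 - b ^ 2) := by
    rw [norm_sub_sq_real, norm_smul, norm_smul, inner_smul_left, inner_smul_right, hu, ← hb,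
      mul_pow, mul_pow, Real.norm_eq_abs, Real.norm_eq_abs, sq_abs, sq_abs]
    simp only [conj_trivial]
    ring
  have ht2 : t ^ 2 * ‖v‖ ^ 2 < 1 := by
    have : (|t| * ‖v‖) ^ 2 < 1 := by
      have : 0 ≤ |t| * ‖v‖ := by positivity
      nlinarith
    rwa [mul_pow, sq_abs] at this
  rw [mem_ball, dist_eq_norm, ← sq_lt_one_iff₀ (norm_nonneg _), e, radius, ← hb, ← sub_lt_iff_lt_add']
  constructor
  · intro h
    exact Real.lt_sqrt_of_sq_lt (by linarith)
  · intro h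
    -- Left of t b the square-root criterion does not apply; there r > 0 gives (r - t b)² < (t b)²,
    -- so the distance is below |t|‖v‖ < 1.
    by_cases hneg : r - t * b < 0
    · have : (r - t * b) ^ 2 < (t * b) ^ 2 := by nlinarith
      nlinarith
    · have := (Real.lt_sqrt (not_lt.1 hneg)).1 h
      linarith

lemma hasDerivAt_radius {u : E} (v : E) :
    HasDerivAt (fun t => radius v t u) (inner ℝ u v) 0 := by
  unfold radius
  have h1 : HasDerivAt (fun t : ℝ => t * (inner ℝ u v : ℝ)) (1 * inner ℝ u v) 0 :=
    (hasDerivAt_id (0 : ℝ)).mul_const _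
  have h2 : HasDerivAt (fun t : ℝ => 1 - t ^ 2 * (‖v‖ ^ 2 - inner ℝ u v ^ 2)) 0 0 := by
    have := ((hasDerivAt_pow 2 (0 : ℝ)).mul_const (‖v‖ ^ 2 - inner ℝ u v ^ 2)).const_sub 1
    simpa using this
  have h3 := h1.add (h2.sqrt (by simp))
  simp only [one_mul, zero_div, add_zero] at h3
  exact h3

end Radius

/-! ### Polar coordinates about a point other than the centre of the ball. -/

section Sphere

variable {E : Type*} [NormedAddCommGroup E] [InnerProductSpace ℝ E] [FiniteDimensional ℝ E]
  [MeasurableSpace E] [BorelSpace E] [Nontrivial E] (ν : Measure E) [ν.IsAddHaarMeasure]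

open Module Metric

/-- Integration in polar coordinates. -/
lemma integral_eq_integral_toSphere {F : E → ℝ} (hF : Integrable F ν) :
    ∫ z, F z ∂ν = ∫ u, ∫ r in Ioi (0 : ℝ), r ^ (finrank ℝ E - 1) * F (r • (u : E))
      ∂volume ∂ν.toSphere := by
  have hmp := ν.measurePreserving_homeomorphUnitSphereProd
  have hemb := (homeomorphUnitSphereProd E).measurableEmbedding
  set G : sphere (0 : E) 1 × Ioi (0 : ℝ) → ℝ := fun q => F (q.2.1 • (q.1 : E)) with hG
  have hcomp : ∀ z : ({(0)}ᶜ : Set E), G (homeomorphUnitSphereProd E z) = F z := by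
    intro z
    have : ‖(z : E)‖ ≠ 0 := norm_ne_zero_iff.2 z.2
    simp [hG, smul_smul, this]
  have hint : Integrable G (ν.toSphere.prod (Measure.volumeIoiPow (finrank ℝ E - 1))) := by
    rw [← hmp.integrable_comp_emb hemb]
    have h1 : Integrable (fun z : ({(0)}ᶜ : Set E) => F z) (ν.comap Subtype.val) := by
      have := (integrableOn_iff_comap_subtypeVal (μ := ν) (f := F)
        (measurableSet_singleton (0 : E)).compl).1 hF.integrableOn
      exact this
    exact h1.congr (Eventually.of_forall fun z => (hcomp z).symm)
  calc
    ∫ z, F z ∂ν = ∫ z : ({(0)}ᶜ : Set E), F z ∂(ν.comap Subtype.val) := by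
      rw [integral_subtype_comap (measurableSet_singleton _).compl F,
        restrict_compl_singleton]
    _ = ∫ q, G q ∂ν.toSphere.prod (Measure.volumeIoiPow (finrank ℝ E - 1)) := by
      rw [← hmp.integral_comp hemb]
      exact integral_congr_ae (Eventually.of_forall fun z => (hcomp z).symm)
    _ = ∫ u, ∫ r, G (u, r) ∂(Measure.volumeIoiPow (finrank ℝ E - 1)) ∂ν.toSphere :=
      integral_prod _ hint
    _ = _ := by
      refine integral_congr_ae (Eventually.of_forall fun u => ?_)
      simp only [Measure.volumeIoiPow, ENNReal.ofReal, hG]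
      rw [integral_withDensity_eq_integral_smul,
        integral_subtype_comap measurableSet_Ioi
          fun r => Real.toNNReal (r ^ (finrank ℝ E - 1)) • F (r • (u : E)),
        setIntegral_congr_fun measurableSet_Ioi fun r hr => ?_]
      · rw [NNReal.smul_def, Real.coe_toNNReal _ (pow_nonneg hr.out.le _), smul_eq_mul]
      · exact (measurable_subtype_coe.pow_const _).real_toNNReal

/-- Integral of a continuous function over a unit ball in polar coordinates around a point that
need not be its centre. -/
lemma integral_ball_translate_eq {g : E → ℝ} (hg : Continuous g) {v : E} {t : ℝ}
    (ht : |t| * ‖v‖ < 1) :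
    ∫ z in ball (0 : E) 1, g (z + t • v) ∂ν =
      ∫ u, ∫ r in (0 : ℝ)..radius v t u, r ^ (finrank ℝ E - 1) * g (r • (u : E))
        ∂volume ∂ν.toSphere := by
  have h1 : ∫ z in ball (0 : E) 1, g (z + t • v) ∂ν = ∫ z in ball (t • v) 1, g z ∂ν := by
    rw [← integral_indicator measurableSet_ball, ← integral_indicator measurableSet_ball,
      ← integral_add_right_eq_self ((ball (t • v) 1).indicator g) (t • v)]
    congr 1
    ext z
    by_cases hz : z ∈ ball (0 : E) 1
    · have hz' : z + t • v ∈ ball (t • v) 1 := by simpa [dist_eq_norm] using hz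
      rw [indicator_of_mem hz, indicator_of_mem hz']
    · have hz' : z + t • v ∉ ball (t • v) 1 := by simpa [dist_eq_norm] using hz
      rw [indicator_of_notMem hz, indicator_of_notMem hz']
  have hint : Integrable ((ball (t • v) 1).indicator g) ν := by
    rw [integrable_indicator_iff measurableSet_ball]
    exact (hg.continuousOn.integrableOn_compact (isCompact_closedBall (t • v) 1)).mono_set
      ball_subset_closedBall
  rw [h1, ← integral_indicator measurableSet_ball, integral_eq_integral_toSphere ν hint]
  refine integral_congr_ae (Eventually.of_forall fun u => ?_)
  have hu : ‖(u : E)‖ = 1 := by simp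
  -- A negative radius would exclude all small r • u from the ball, although the origin is an
  -- interior point.
  have hR : 0 ≤ radius v t u := by
    by_contra hneg
    have h0 : ∀ r : ℝ, 0 < r → r • (u : E) ∉ ball (t • v) 1 := fun r hr hm => by
      linarith [(smul_mem_ball_iff hu ht hr).1 hm]
    have hc : Tendsto (fun r : ℝ => dist (r • (u : E)) (t • v)) (𝓝[>] 0)
        (𝓝 (dist ((0 : ℝ) • (u : E)) (t • v))) := by
      have : Continuous (fun r : ℝ => dist (r • (u : E)) (t • v)) := by fun_prop
      exact (this.tendsto 0).mono_left nhdsWithin_le_nhds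
    have h2 : dist ((0 : ℝ) • (u : E)) (t • v) < 1 := by
      simpa [dist_eq_norm, norm_smul] using ht
    obtain ⟨r, hr, hr0⟩ := ((hc.eventually (gt_mem_nhds h2)).and self_mem_nhdsWithin).exists
    exact h0 r hr0 hr
  simp only
  rw [intervalIntegral.integral_of_le hR, integral_Ioc_eq_integral_Ioo,
    ← integral_indicator measurableSet_Ioi, ← integral_indicator measurableSet_Ioo]
  congr 1
  ext r
  by_cases hr : 0 < r
  · by_cases hr2 : r < radius v t u
    · rw [indicator_of_mem (show r ∈ Ioi (0 : ℝ) from hr),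
        indicator_of_mem (show r ∈ Ioo 0 (radius v t (u : E)) from ⟨hr, hr2⟩),
        indicator_of_mem ((smul_mem_ball_iff hu ht hr).2 hr2)]
    · rw [indicator_of_mem (show r ∈ Ioi (0 : ℝ) from hr),
        indicator_of_notMem (show r ∉ Ioo 0 (radius v t (u : E)) from fun h => hr2 h.2),
        indicator_of_notMem (fun h => hr2 ((smul_mem_ball_iff hu ht hr).1 h)), mul_zero]
  · rw [indicator_of_notMem (show r ∉ Ioi (0 : ℝ) from hr),
      indicator_of_notMem (show r ∉ Ioo 0 (radius v t (u : E)) from fun h => hr h.1)]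

/-- The derivative of a ball average along a translation is an average over the sphere. -/
lemma hasDerivAt_integral_ball_translate {g : E → ℝ} (hg : Continuous g) (v : E) :
    HasDerivAt (fun t : ℝ => ∫ z in ball (0 : E) 1, g (z + t • v) ∂ν)
      (∫ u, g (u : E) * inner ℝ (u : E) v ∂ν.toSphere) 0 := by
  set n := finrank ℝ E - 1 with hn
  set H : sphere (0 : E) 1 → ℝ → ℝ := fun u r => r ^ n * g (r • (u : E)) with hH
  have hHc : Continuous (Function.uncurry H) := by
    simp only [hH, Function.uncurry_def]
    fun_prop
  have hHu : ∀ u, Continuous (H u) := fun u => hHc.comp (Continuous.prodMk_right u)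
  -- The polar centre stays at the origin, so t enters only through the upper limit of integration.
  -- This is why g need only be continuous.
  set Φ : ℝ → sphere (0 : E) 1 → ℝ := fun t u => ∫ r in (0 : ℝ)..radius v t u, H u r with hΦ
  have hΦc : ∀ t, Continuous (Φ t) := fun t =>
    intervalIntegral.continuous_parametric_intervalIntegral_of_continuous hHc
      ((continuous_radius v t).comp continuous_subtype_val)
  -- Chosen so that |t|‖v‖ ≤ 1/2; the radii then stay in [0, 2], where the integrand is bounded by a
  -- constant.
  set δ : ℝ := 1 / (2 * (‖v‖ + 1)) with hδ
  have hδ0 : 0 < δ := by positivity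
  have hball : ∀ t ∈ ball (0 : ℝ) δ, |t| * ‖v‖ ≤ 1 / 2 := by
    intro t ht
    rw [mem_ball, dist_zero_right, Real.norm_eq_abs] at ht
    have : |t| * ‖v‖ ≤ δ * (‖v‖ + 1) :=
      mul_le_mul ht.le (by linarith) (norm_nonneg _) hδ0.le
    refine this.trans (le_of_eq ?_)
    rw [hδ]
    field_simp
  obtain ⟨M, hM⟩ : ∃ M, ∀ q ∈ (univ : Set (sphere (0 : E) 1)) ×ˢ Icc (0 : ℝ) 2,
      ‖Function.uncurry H q‖ ≤ M :=
    (isCompact_univ.prod isCompact_Icc).exists_bound_of_continuousOn hHc.continuousOn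
  have hint : ∀ {G : sphere (0 : E) 1 → ℝ}, Continuous G → Integrable G ν.toSphere := fun hG =>
    hG.integrable_of_hasCompactSupport (HasCompactSupport.of_compactSpace _)
  have key := hasFDerivAt_integral_of_dominated_loc_of_lip' (μ := ν.toSphere) (𝕜 := ℝ)
    (F := Φ) (x₀ := 0)
    (F' := fun u => ContinuousLinearMap.toSpanSingleton ℝ (g (u : E) * inner ℝ (u : E) v))
    (s := ball 0 δ) (bound := fun _ => M * (2 * ‖v‖)) (ball_mem_nhds _ hδ0)
    (fun t _ => (hΦc t).aestronglyMeasurable) (hint (hΦc 0))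
    (by
      refine Continuous.aestronglyMeasurable ?_
      refine ((ContinuousLinearMap.toSpanSingletonCLE (𝕜 := ℝ) (E := ℝ)).continuous).comp ?_
      fun_prop)
    (Eventually.of_forall fun u t ht => by
      have hu : ‖(u : E)‖ = 1 := by simp
      have h1 := hball t ht
      have h2 := abs_radius_sub_one_le (v := v) hu (h1.trans (by norm_num))
      have h3 : Φ t u - Φ 0 u = ∫ r in (1 : ℝ)..radius v t u, H u r := by
        simp only [hΦ, radius_zero]
        exact intervalIntegral.integral_interval_sub_left
          ((hHu u).intervalIntegrable _ _) ((hHu u).intervalIntegrable _ _)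
      rw [h3, sub_zero, Real.norm_eq_abs t]
      have h4 : ∀ r ∈ uIoc (1 : ℝ) (radius v t u), ‖H u r‖ ≤ M := by
        intro r hr
        refine hM (u, r) ⟨mem_univ _, ?_⟩
        have h5 := abs_le.1 h2
        rcases mem_uIoc.1 hr with h | h
        · exact ⟨by linarith, by linarith⟩
        · exact ⟨by linarith, by linarith⟩
      refine (intervalIntegral.norm_integral_le_of_norm_le_const h4).trans ?_
      have hM0 : 0 ≤ M := (norm_nonneg _).trans (hM (u, 0) ⟨mem_univ _, by norm_num, by norm_num⟩)
      calc M * |radius v t u - 1| ≤ M * (2 * (|t| * ‖v‖)) := mul_le_mul_of_nonneg_left h2 hM0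
        _ = M * (2 * ‖v‖) * |t| := by ring)
    (integrable_const _)
    (Eventually.of_forall fun u => by
      -- The fundamental theorem of calculus at R = 1, where r^(n) = 1, composed with the derivative
      -- ⟨u, v⟩ of the radius.
      have h1 : HasDerivAt (fun R => ∫ r in (0 : ℝ)..R, H u r) (H u 1) (radius v 0 (u : E)) := by
        rw [radius_zero]
        exact ((hHu u).integral_hasStrictDerivAt 0 1).hasDerivAt
      have h2 := h1.comp (0 : ℝ) (hasDerivAt_radius (u := (u : E)) v)
      have h3 : H u 1 = g (u : E) := by simp [hH]
      rw [h3] at h2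
      exact h2.hasFDerivAt)
  have hd := key.2.hasDerivAt
  rw [ContinuousLinearMap.integral_apply key.1] at hd
  simp only [ContinuousLinearMap.toSpanSingleton_apply, one_smul] at hd
  refine hd.congr_of_eventuallyEq ?_
  filter_upwards [ball_mem_nhds (0 : ℝ) hδ0] with t ht
  exact integral_ball_translate_eq ν hg (lt_of_le_of_lt (hball t ht) (by norm_num))

/-- A convexity inequality for the sphere averages that estimate gradients of ball averages. -/
lemma integral_toSphere_le {g : E → ℝ} (hg : Continuous g) (v : E) (c B : ℝ)
    (hconv : ∀ z ∈ ball (0 : E) 1, ∀ t : ℝ, 0 < t → t ≤ 1 →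
      g (z + t • v) ≤ t * g (z + v) + (1 - t) * g z + t * c)
    (hB : ∀ z ∈ ball (0 : E) 1, g (z + v) - g z ≤ B) :
    ∫ u, g (u : E) * inner ℝ (u : E) v ∂ν.toSphere ≤ (B + c) * ν.real (ball 0 1) := by
  have hd := hasDerivAt_integral_ball_translate ν hg v
  have hd' := (hasDerivWithinAt_iff_tendsto_slope' (s := Ioi (0 : ℝ)) (by simp)).1
    hd.hasDerivWithinAt
  -- Convexity bounds every difference quotient with 0 < t ≤ 1 by the same constant, so the bound
  -- passes to the derivative.
  refine le_of_tendsto hd' ?_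
  have hint : ∀ {G : E → ℝ}, Continuous G → IntegrableOn G (ball 0 1) ν := fun hG =>
    (hG.continuousOn.integrableOn_compact (isCompact_closedBall (0 : E) 1)).mono_set
      ball_subset_closedBall
  filter_upwards [Ioc_mem_nhdsGT (zero_lt_one' ℝ)] with t ht
  rw [slope_def_field, sub_zero, div_le_iff₀ ht.1, zero_smul]
  simp only [add_zero]
  rw [← integral_sub (hint (by fun_prop)) (hint hg)]
  calc ∫ z in ball (0 : E) 1, (g (z + t • v) - g z) ∂ν
      ≤ ∫ z in ball (0 : E) 1, (B + c) * t ∂ν := by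
        refine setIntegral_mono_on ((hint (by fun_prop)).sub (hint hg))
          (hint continuous_const) measurableSet_ball fun z hz => ?_
        have h1 := hconv z hz t ht.1 ht.2
        have h2 := mul_le_mul_of_nonneg_left (hB z hz) ht.1.le
        linarith
    _ = (B + c) * ν.real (ball 0 1) * t := by
        rw [setIntegral_const, smul_eq_mul]
        ring

end Sphere

/-! ### The uniform distribution on the sphere -/

section SphereUniform

variable {d : ℕ}

lemma isProbabilityMeasure_sphereUniform [NeZero d] : IsProbabilityMeasure (sphereUniform d) := by
  have : IsProbabilityMeasure
      (cond (volume : Measure (EuclideanSpace ℝ (Fin d))).toSphere univ) := by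
    refine cond_isProbabilityMeasure ?_
    rw [Ne, Measure.measure_univ_eq_zero]
    exact Measure.toSphere_ne_zero _
  exact Measure.isProbabilityMeasure_map measurable_subtype_coe.aemeasurable

lemma ae_sphereUniform : ∀ᵐ w ∂sphereUniform d, ‖w‖ = 1 := by
  rw [sphereUniform, ae_map_iff measurable_subtype_coe.aemeasurable
    (measurableSet_eq_fun (by fun_prop) (by fun_prop))]
  exact Eventually.of_forall fun u => by simp

/-- The surface measure has mass d · vol(ball); this d cancels the factor d of the gradient
estimator. -/
lemma integral_sphereUniform {G : EuclideanSpace ℝ (Fin d) → ℝ} (hG : Continuous G) :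
    ∫ w, G w ∂sphereUniform d =
      (d * (volume : Measure (EuclideanSpace ℝ (Fin d))).real (Metric.ball 0 1))⁻¹ *
        ∫ u, G (u : EuclideanSpace ℝ (Fin d))
          ∂(volume : Measure (EuclideanSpace ℝ (Fin d))).toSphere := by
  rw [sphereUniform, integral_map measurable_subtype_coe.aemeasurable hG.aestronglyMeasurable,
    ProbabilityTheory.cond, Measure.restrict_univ, integral_smul_measure, ENNReal.toReal_inv, smul_eq_mul]
  congr 2
  change (Measure.real _ univ) = _
  rw [Measure.toSphere_real_apply_univ, finrank_euclideanSpace_fin]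

end SphereUniform

/-! ### Consequences of the assumptions on the problem -/

section Problem

variable {d : ℕ} {Ξ : Type u} [MeasurableSpace Ξ] {P : Measure Ξ}
  {F : EuclideanSpace ℝ (Fin d) → Ξ → ℝ} {f h : EuclideanSpace ℝ (Fin d) → EReal}
  {ρ : ℝ} {p : Fin d → ℝ} {L D μ : ℝ} {x y z : EuclideanSpace ℝ (Fin d)}

lemma effDom_subset_evalRegion (hμ : 0 ≤ μ) : effDom h ⊆ evalRegion h μ :=
  fun x hx => ⟨x, hx, by simpa using hμ⟩

lemma add_smul_mem_evalRegion (hμ : 0 ≤ μ) (hx : x ∈ effDom h) (hz : ‖z‖ ≤ 1) :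
    x + μ • z ∈ evalRegion h μ := by
  refine ⟨x, hx, ?_⟩
  rw [add_sub_cancel_left, norm_smul, Real.norm_eq_abs, abs_of_nonneg hμ]
  exact mul_le_of_le_one_right hμ hz

/-- A globally Lipschitz function that agrees with the objective where it is finite by
assumption. -/
structure IsExtension (P : Measure Ξ) (F : EuclideanSpace ℝ (Fin d) → Ξ → ℝ)
    (f h : EuclideanSpace ℝ (Fin d) → EReal) (L μ : ℝ) (r : EuclideanSpace ℝ (Fin d) → ℝ) :
    Prop where
  lipschitz : ∀ x y, |r x - r y| ≤ L * ‖x - y‖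
  eq_coe : ∀ x ∈ evalRegion h μ, f x = (r x : EReal)
  eq_integral : ∀ x ∈ evalRegion h μ, r x = ∫ s, F x s ∂P

namespace IsProblem

/-- The sign of L is forced by the Lipschitz condition at two points of the region at distance μ. -/
lemma lipschitzConst_nonneg [NeZero d] [IsProbabilityMeasure P]
    (hp : IsProblem P F f h ρ p L D μ) (hμ : 0 < μ)
    (hx : x ∈ effDom h) : 0 ≤ L := by
  have : Nonempty Ξ := nonempty_of_isProbabilityMeasure P
  obtain ⟨s⟩ := this
  set e : EuclideanSpace ℝ (Fin d) := EuclideanSpace.single 0 1 with he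
  have hne : ‖e‖ = 1 := by simp [he]
  have h1 := hp.F_lipschitz s _ (add_smul_mem_evalRegion hμ.le hx hne.le) x
    (effDom_subset_evalRegion hμ.le hx)
  rw [add_sub_cancel_left, norm_smul, hne, Real.norm_eq_abs, abs_of_pos hμ, mul_one] at h1
  exact nonneg_of_mul_nonneg_left ((abs_nonneg _).trans h1) hμ

lemma diam_nonneg [NeZero d] (hp : IsProblem P F f h ρ p L D μ) (hx : x ∈ effDom h) : 0 ≤ D := by
  simpa using hp.dom_bounded x hx x hx 0

/-- The expectation is L-Lipschitz on the region and extends to the whole space with the same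
constant. A continuous real function defined everywhere is what the ball averages require. -/
lemma exists_isExtension [IsProbabilityMeasure P] (hp : IsProblem P F f h ρ p L D μ)
    (hL : 0 ≤ L) : ∃ r, IsExtension P F f h L μ r := by
  have hlip : LipschitzOnWith (Real.toNNReal L) (fun x => ∫ s, F x s ∂P) (evalRegion h μ) := by
    refine LipschitzOnWith.of_dist_le_mul fun x hx y hy => ?_
    rw [Real.dist_eq, ← integral_sub (hp.F_integrable x hx) (hp.F_integrable y hy),
      Real.coe_toNNReal _ hL, dist_eq_norm, ← Real.norm_eq_abs]
    refine (norm_integral_le_of_norm_le_const (C := L * ‖x - y‖)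
      (Eventually.of_forall fun s => hp.F_lipschitz s x hx y hy)).trans ?_
    simp
  obtain ⟨r, hr, heq⟩ := hlip.extend_real
  refine ⟨r, fun x y => ?_, fun x hx => ?_, fun x hx => (heq hx).symm⟩
  · have := hr.dist_le_mul x y
    rwa [Real.dist_eq, Real.coe_toNNReal _ hL, dist_eq_norm] at this
  · rw [hp.f_eq x hx]
    exact congrArg _ (heq hx)

lemma convex_h (hp : IsProblem P F f h ρ p L D μ) (hx : x ∈ effDom h) (hy : y ∈ effDom h)
    {t : ℝ} (ht : 0 ≤ t) (ht1 : t ≤ 1) :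
    h (t • x + (1 - t) • y) ≤ ((t * (h x).toReal + (1 - t) * (h y).toReal : ℝ) : EReal) := by
  have := hp.h_convex x y t ht ht1
  rw [← EReal.coe_toReal (ne_of_lt hx) (hp.h_ne_bot x),
    ← EReal.coe_toReal (ne_of_lt hy) (hp.h_ne_bot y)] at this
  exact_mod_cast this

lemma convexCombo_mem (hp : IsProblem P F f h ρ p L D μ) (hx : x ∈ effDom h) (hy : y ∈ effDom h)
    {t : ℝ} (ht : 0 ≤ t) (ht1 : t ≤ 1) : t • x + (1 - t) • y ∈ effDom h :=
  lt_of_le_of_lt (hp.convex_h hx hy ht ht1) (EReal.coe_lt_top _)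

lemma lsc_h (hp : IsProblem P F f h ρ p L D μ) : LowerSemicontinuous h := by
  rw [lowerSemicontinuous_iff_isClosed_preimage]
  intro b
  induction b with
  | bot =>
    convert isClosed_empty
    ext x
    simpa using hp.h_ne_bot x
  | top =>
    convert isClosed_univ
    ext x
    simp
  | coe b =>
    -- A sublevel set is a horizontal slice of the closed epigraph.
    exact hp.h_closed.preimage (f := fun x => (x, b)) (by fun_prop)

lemma proxRegular_h (hp : IsProblem P F f h ρ p L D μ) (hx : x ∈ effDom h) :
    ProxRegular h 0 D 0 where
  lsc := hp.lsc_h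
  ne_bot := hp.h_ne_bot
  nonempty := ⟨x, hx⟩
  bounded := hp.dom_bounded
  convex x hx y hy t ht ht1 := by
    rw [zero_mul, add_zero]
    exact hp.convex_h hx hy ht ht1

end IsProblem

namespace IsExtension

variable {r : EuclideanSpace ℝ (Fin d) → ℝ}

lemma continuous (hr : IsExtension P F f h L μ r) : Continuous r := by
  refine (LipschitzWith.of_dist_le_mul (K := Real.toNNReal L) fun x y => ?_).continuous
  rw [Real.dist_eq, dist_eq_norm]
  exact (hr.lipschitz x y).trans
    (mul_le_mul_of_nonneg_right (Real.le_coe_toNNReal L) (norm_nonneg _))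

/-- Where f and r may differ, h is `⊤` and f is not `⊥`, so both sums are `⊤`. -/
lemma add_eq (hp : IsProblem P F f h ρ p L D μ) (hμ : 0 ≤ μ) (hr : IsExtension P F f h L μ r) :
    f + h = fun x => (r x : EReal) + h x := by
  funext x
  by_cases hx : x ∈ effDom h
  · rw [Pi.add_apply, hr.eq_coe x (effDom_subset_evalRegion hμ hx)]
  · have : h x = ⊤ := by simpa [effDom] using hx
    rw [Pi.add_apply, this, EReal.add_top_of_ne_bot (hp.f_ne_bot x),
      EReal.add_top_of_ne_bot (EReal.coe_ne_bot _)]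

lemma effDom_add (hp : IsProblem P F f h ρ p L D μ) (hμ : 0 ≤ μ)
    (hr : IsExtension P F f h L μ r) : effDom (f + h) = effDom h := by
  rw [hr.add_eq hp hμ]
  ext x
  simp only [effDom, mem_ofPred_eq]
  constructor
  · intro hx
    by_contra hh
    rw [not_lt_top_iff] at hh
    rw [hh, EReal.add_top_of_ne_bot (EReal.coe_ne_bot _)] at hx
    exact lt_irrefl _ hx
  · intro hx
    exact EReal.add_lt_top (EReal.coe_ne_top _) hx.ne

lemma toReal_add (hp : IsProblem P F f h ρ p L D μ) (hμ : 0 ≤ μ)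
    (hr : IsExtension P F f h L μ r) (hx : x ∈ effDom h) :
    ((f + h) x).toReal = r x + (h x).toReal := by
  rw [hr.add_eq hp hμ]
  simp only
  rw [EReal.toReal_add (EReal.coe_ne_top _) (EReal.coe_ne_bot _) (ne_of_lt hx) (hp.h_ne_bot x),
    EReal.toReal_coe]

lemma convexCombo_le (hp : IsProblem P F f h ρ p L D μ)
    (hr : IsExtension P F f h L μ r) (hx : x ∈ evalRegion h μ) (hy : y ∈ evalRegion h μ)
    {t : ℝ} (ht : 0 ≤ t) (ht1 : t ≤ 1) (hxy : t • x + (1 - t) • y ∈ evalRegion h μ) :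
    r (t • x + (1 - t) • y) ≤
      t * r x + (1 - t) * r y + ρ / 2 * (t * (1 - t) * wnormSq p (x - y)) := by
  have := hp.f_weaklyConvex x y t ht ht1
  simp only [hr.eq_coe _ hx, hr.eq_coe _ hy, hr.eq_coe _ hxy, scaledNormSq_diagonal,
    wnormSq_convexCombo] at this
  have h2 : r (t • x + (1 - t) • y) + ρ / 2 * (t * wnormSq p x + (1 - t) * wnormSq p y -
      t * (1 - t) * wnormSq p (x - y)) ≤ t * (r x + ρ / 2 * wnormSq p x) +
      (1 - t) * (r y + ρ / 2 * wnormSq p y) := by exact_mod_cast this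
  linarith

lemma proxRegular_add (hp : IsProblem P F f h ρ p L D μ) (hμ : 0 ≤ μ)
    (hr : IsExtension P F f h L μ r) (hx₀ : x ∈ effDom h) :
    ProxRegular (f + h) (ρ / 2) D p where
  lsc := by
    rw [hr.add_eq hp hμ]
    exact (continuous_coe_real_ereal.comp hr.continuous).lowerSemicontinuous.add' hp.lsc_h
      fun y => EReal.continuousAt_add (Or.inl (EReal.coe_ne_top _)) (Or.inl (EReal.coe_ne_bot _))
  ne_bot x := by
    rw [hr.add_eq hp hμ]
    simp [EReal.add_eq_bot_iff, hp.h_ne_bot x]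
  nonempty := ⟨x, by rwa [hr.effDom_add hp hμ]⟩
  bounded := by
    rw [hr.effDom_add hp hμ]
    exact hp.dom_bounded
  convex := by
    rw [hr.effDom_add hp hμ]
    intro x hx y hy t ht ht1
    have hm := hp.convexCombo_mem hx hy ht ht1
    have h1 := hr.convexCombo_le hp (effDom_subset_evalRegion hμ hx)
      (effDom_subset_evalRegion hμ hy) ht ht1 (effDom_subset_evalRegion hμ hm)
    rw [hr.toReal_add hp hμ hx, hr.toReal_add hp hμ hy, hr.add_eq hp hμ]
    refine (add_le_add (EReal.coe_le_coe_iff.2 h1) (hp.convex_h hx hy ht ht1)).trans (le_of_eq ?_)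
    rw [← EReal.coe_add]
    congr 1
    ring

end IsExtension

/-! ### The gradient estimator -/

lemma measurable_gradEstimator (hF : Measurable (Function.uncurry F)) :
    Measurable fun q : EuclideanSpace ℝ (Fin d) × (Ξ × EuclideanSpace ℝ (Fin d)) =>
      gradEstimator F μ q.1 q.2.1 q.2.2 := by
  unfold gradEstimator
  have h1 : Measurable fun q : EuclideanSpace ℝ (Fin d) × (Ξ × EuclideanSpace ℝ (Fin d)) =>
      F (q.1 + μ • q.2.2) q.2.1 :=
    hF.comp (f := fun q : EuclideanSpace ℝ (Fin d) × (Ξ × EuclideanSpace ℝ (Fin d)) =>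
      (q.1 + μ • q.2.2, q.2.1)) (by fun_prop)
  have h2 : Measurable fun q : EuclideanSpace ℝ (Fin d) × (Ξ × EuclideanSpace ℝ (Fin d)) =>
      F q.1 q.2.1 :=
    hF.comp (f := fun q : EuclideanSpace ℝ (Fin d) × (Ξ × EuclideanSpace ℝ (Fin d)) =>
      (q.1, q.2.1)) (by fun_prop)
  exact (measurable_const.mul (h1.sub h2)).smul (by fun_prop)

/-- Over a distance μ the function F changes by at most Lμ, so 1/μ cancels and the bound is free of
μ. -/
lemma norm_gradEstimator_le (hp : IsProblem P F f h ρ p L D μ) (hμ : 0 < μ)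
    (hx : x ∈ effDom h) (s : Ξ) {w : EuclideanSpace ℝ (Fin d)} (hw : ‖w‖ = 1) :
    ‖gradEstimator F μ x s w‖ ≤ d * L := by
  have h1 := hp.F_lipschitz s _ (add_smul_mem_evalRegion hμ.le hx hw.le) x
    (effDom_subset_evalRegion hμ.le hx)
  rw [add_sub_cancel_left, norm_smul, hw, Real.norm_eq_abs, abs_of_pos hμ, mul_one] at h1
  rw [gradEstimator, norm_smul, hw, mul_one, norm_mul, norm_div, Real.norm_natCast,
    Real.norm_eq_abs, Real.norm_eq_abs, abs_of_pos hμ]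
  calc (d : ℝ) / μ * |F (x + μ • w) s - F x s| ≤ d / μ * (L * μ) :=
        mul_le_mul_of_nonneg_left h1 (by positivity)
    _ = d * L := by field_simp

lemma integrable_inner_gradEstimator [NeZero d] [IsProbabilityMeasure P]
    (hp : IsProblem P F f h ρ p L D μ) (hμ : 0 < μ) (hx : x ∈ effDom h)
    (y : EuclideanSpace ℝ (Fin d)) :
    Integrable (fun z : Ξ × EuclideanSpace ℝ (Fin d) =>
      (inner ℝ (gradEstimator F μ x z.1 z.2) (y - x) : ℝ)) (P.prod (sphereUniform d)) := by
  have := isProbabilityMeasure_sphereUniform (d := d)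
  refine Integrable.of_bound (C := d * L * ‖y - x‖) ?_ ?_
  · have : Measurable fun z : Ξ × EuclideanSpace ℝ (Fin d) => gradEstimator F μ x z.1 z.2 :=
      (measurable_gradEstimator hp.F_measurable).comp measurable_prodMk_left
    exact this.inner_const.aestronglyMeasurable
  · filter_upwards [Measure.quasiMeasurePreserving_snd.ae ae_sphereUniform] with z hz
    exact (norm_inner_le_norm _ _).trans (mul_le_mul_of_nonneg_right
      (norm_gradEstimator_le hp hμ hx z.1 hz) (norm_nonneg _))

/-- First-order convexity inequality for the gradient estimator in expectation. -/
lemma integral_inner_gradEstimator_le [NeZero d] [IsProbabilityMeasure P]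
    (hp : IsProblem P F f h ρ p L D μ) (hμ : 0 < μ) (hρ : 0 ≤ ρ)
    {r : EuclideanSpace ℝ (Fin d) → ℝ}
    (hr : IsExtension P F f h L μ r) (hx : x ∈ effDom h) (hy : y ∈ effDom h) :
    ∫ q, inner ℝ (gradEstimator F μ x q.1 q.2) (y - x) ∂P.prod (sphereUniform d) ≤
      r y - r x + ρ / 2 * wnormSq p (y - x) + 2 * (L * μ) := by
  have := isProbabilityMeasure_sphereUniform (d := d)
  have hL := hp.lipschitzConst_nonneg hμ hx
  have hint := integrable_inner_gradEstimator hp hμ hx y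
  -- In the coordinate x + μ z the smoothing ball at x is the unit ball, and translation by v
  -- carries it to the smoothing ball at y.
  set v : EuclideanSpace ℝ (Fin d) := μ⁻¹ • (y - x) with hv
  have hμv : μ • v = y - x := by rw [hv, smul_smul, mul_inv_cancel₀ hμ.ne', one_smul]
  set g : EuclideanSpace ℝ (Fin d) → ℝ := fun z => r (x + μ • z) - r x with hg
  have hrc := hr.continuous
  have hgc : Continuous g := by fun_prop
  have hinner : ∀ w : EuclideanSpace ℝ (Fin d), ‖w‖ = 1 →
      ∫ s, inner ℝ (gradEstimator F μ x s w) (y - x) ∂P = d * (g w * inner ℝ w v) := by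
    intro w hw
    have hm := add_smul_mem_evalRegion hμ.le hx hw.le
    have hm' := effDom_subset_evalRegion hμ.le hx
    have e : ∀ s, inner ℝ (gradEstimator F μ x s w) (y - x) =
        d * inner ℝ w v * (F (x + μ • w) s - F x s) := by
      intro s
      rw [gradEstimator, inner_smul_left, hv, inner_smul_right]
      simp only [conj_trivial]
      field_simp
    simp only [e]
    rw [integral_const_mul, integral_sub (hp.F_integrable _ hm) (hp.F_integrable _ hm'),
      ← hr.eq_integral _ hm, ← hr.eq_integral _ hm']
    ring
  have hvol : 0 < (volume : Measure (EuclideanSpace ℝ (Fin d))).real (Metric.ball 0 1) :=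
    ENNReal.toReal_pos (Metric.measure_ball_pos _ _ one_pos).ne' measure_ball_lt_top.ne
  have hd : (0 : ℝ) < d := Nat.cast_pos.2 (NeZero.pos d)
  -- The term 2Lμ is the cost of replacing r(y + μ z) - r(x + μ z) by r y - r x.
  have key := integral_toSphere_le (volume : Measure (EuclideanSpace ℝ (Fin d))) hgc v
    (ρ / 2 * wnormSq p (y - x)) (r y - r x + 2 * (L * μ))
    (fun z hz t ht ht1 => by
      have hz1 : ‖z‖ ≤ 1 := by simpa using (Metric.mem_ball.1 hz).le
      have e1 : x + μ • (z + t • v) = t • (y + μ • z) + (1 - t) • (x + μ • z) := by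
        rw [smul_add, smul_comm μ t v, hμv]
        module
      have e2 : t • (y + μ • z) + (1 - t) • (x + μ • z) = (t • y + (1 - t) • x) + μ • z := by
        module
      have e3 : x + μ • (z + v) = y + μ • z := by
        rw [smul_add, hμv]
        module
      have hc := hr.convexCombo_le hp (add_smul_mem_evalRegion hμ.le hy hz1)
        (add_smul_mem_evalRegion hμ.le hx hz1) ht.le ht1
        (by rw [e2]
            exact add_smul_mem_evalRegion hμ.le (hp.convexCombo_mem hy hx ht.le ht1) hz1)
      have e4 : y + μ • z - (x + μ • z) = y - x := by abel
      rw [e4] at hc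
      have hw : 0 ≤ wnormSq p (y - x) := wnormSq_nonneg (fun i => (hp.p_pos i).le) _
      have h5 : ρ / 2 * (t * (1 - t) * wnormSq p (y - x)) ≤
          t * (ρ / 2 * wnormSq p (y - x)) := by
        have : 0 ≤ ρ / 2 * (t * t * wnormSq p (y - x)) := by positivity
        linarith
      simp only [hg, e1, e3]
      linarith)
    (fun z hz => by
      have hz1 : ‖z‖ ≤ 1 := by simpa using (Metric.mem_ball.1 hz).le
      have e3 : x + μ • (z + v) = y + μ • z := by
        rw [smul_add, hμv]
        module
      have hl : ∀ x : EuclideanSpace ℝ (Fin d), |r (x + μ • z) - r x| ≤ L * μ := by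
        intro x
        refine (hr.lipschitz _ _).trans (mul_le_mul_of_nonneg_left ?_ hL)
        rw [add_sub_cancel_left, norm_smul, Real.norm_eq_abs, abs_of_pos hμ]
        exact mul_le_of_le_one_right hμ.le hz1
      have h1 := abs_le.1 (hl x)
      have h2 := abs_le.1 (hl y)
      simp only [hg, e3]
      linarith)
  calc ∫ q, inner ℝ (gradEstimator F μ x q.1 q.2) (y - x) ∂P.prod (sphereUniform d)
      = ∫ w, ∫ s, inner ℝ (gradEstimator F μ x s w) (y - x) ∂P ∂sphereUniform d :=
        integral_prod_symm _ hint
    _ = ∫ w, d * (g w * inner ℝ w v) ∂sphereUniform d := by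
        refine integral_congr_ae ?_
        filter_upwards [ae_sphereUniform] with w hw
        exact hinner w hw
    _ = d * ((d * (volume : Measure (EuclideanSpace ℝ (Fin d))).real (Metric.ball 0 1))⁻¹ *
          ∫ u, g (u : EuclideanSpace ℝ (Fin d)) * inner ℝ (u : EuclideanSpace ℝ (Fin d)) v
            ∂(volume : Measure (EuclideanSpace ℝ (Fin d))).toSphere) := by
        rw [integral_const_mul, integral_sphereUniform (G := fun w => g w * inner ℝ w v)
          (by fun_prop)]
    _ ≤ d * ((d * (volume : Measure (EuclideanSpace ℝ (Fin d))).real (Metric.ball 0 1))⁻¹ *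
          ((r y - r x + 2 * (L * μ) + ρ / 2 * wnormSq p (y - x)) *
            (volume : Measure (EuclideanSpace ℝ (Fin d))).real (Metric.ball 0 1))) := by
        gcongr
    _ = r y - r x + ρ / 2 * wnormSq p (y - x) + 2 * (L * μ) := by
        field_simp
        ring

end Problem

/-! ### Measurability of the proximal map -/

lemma ProxRegular.measurable_prox {d : ℕ} {φ : EuclideanSpace ℝ (Fin d) → EReal} {κ D ζ : ℝ}
    {p : Fin d → ℝ} (hφ : ProxRegular φ κ D p) (hκ : 0 ≤ κ) (hc : κ < 1 / (2 * ζ))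
    {A : Type*} [MeasurableSpace A] {w : A → Fin d → ℝ} {x : A → EuclideanSpace ℝ (Fin d)}
    (hw : Measurable w) (hpos : ∀ a i, 0 < w a i ∧ p i ≤ w a i) (hx : Measurable x) :
    Measurable fun a => prox φ ζ (Matrix.diagonal (w a)) (x a) :=
  (hφ.continuous_prox hκ hc).measurable.comp
    (f := fun a => ((⟨w a, hpos a⟩ : {w : Fin d → ℝ // ∀ i, 0 < w i ∧ p i ≤ w i}), x a))
    ((hw.subtype_mk).prodMk hx)

/-! ### Properties of the iterates -/

section Run

variable {d : ℕ} {Ξ : Type u} {F : EuclideanSpace ℝ (Fin d) → Ξ → ℝ}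
  {h : EuclideanSpace ℝ (Fin d) → EReal} {β₂ β₃ μ : ℝ} {a b : ℕ → ℝ}
  {x₀ : EuclideanSpace ℝ (Fin d)} {q : Fin d → ℝ} {ξ ξ' : ℕ → Ξ}
  {w w' : ℕ → EuclideanSpace ℝ (Fin d)}

/-- The maximum in the update makes the metric monotone; this lets its increments telescope and
keeps the weights above p. -/
lemma run_vhat_le_succ (hβ₃ : β₃ ≤ 1) (t : ℕ) (i : Fin d) :
    (run F h β₂ β₃ μ a b x₀ q ξ w t).vhat i ≤ (run F h β₂ β₃ μ a b x₀ q ξ w (t + 1)).vhat i := by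
  set s := run F h β₂ β₃ μ a b x₀ q ξ w t with hs
  set s' := run F h β₂ β₃ μ a b x₀ q ξ w (t + 1) with hs'
  have e : s'.vhat i = β₃ * s.vhat i + (1 - β₃) * max (s.vhat i) (s'.v i) := rfl
  rw [e]
  have := mul_le_mul_of_nonneg_left (le_max_left (s.vhat i) (s'.v i)) (sub_nonneg.2 hβ₃)
  linarith

lemma le_run_vhat (hβ₃ : β₃ ≤ 1) (t : ℕ) (i : Fin d) :
    q i ≤ (run F h β₂ β₃ μ a b x₀ q ξ w t).vhat i := by
  induction t with
  | zero => exact le_rfl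
  | succ t ih => exact ih.trans (run_vhat_le_succ hβ₃ t i)

lemma run_x_mem {D : ℝ} {p : Fin d → ℝ} (hh : ProxRegular h 0 D p) (hx₀ : x₀ ∈ effDom h) (t : ℕ) :
    (run F h β₂ β₃ μ a b x₀ q ξ w t).x ∈ effDom h := by
  cases t with
  | zero => exact hx₀
  | succ t => exact hh.prox_mem _

/-- The state before iteration t uses only earlier samples; this is the source of its independence
from sample t. -/
lemma run_congr {t : ℕ} (hξ : ∀ s < t, ξ s = ξ' s) (hw : ∀ s < t, w s = w' s) :
    run F h β₂ β₃ μ a b x₀ q ξ w t = run F h β₂ β₃ μ a b x₀ q ξ' w' t := by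
  induction t with
  | zero => rfl
  | succ t ih =>
    rw [run, run, ih (fun s hs => hξ s (hs.trans t.lt_succ_self))
      (fun s hs => hw s (hs.trans t.lt_succ_self)), hξ t t.lt_succ_self, hw t t.lt_succ_self]

/-- The gradient estimate of iteration `t`. -/
noncomputable def runGrad (F : EuclideanSpace ℝ (Fin d) → Ξ → ℝ)
    (h : EuclideanSpace ℝ (Fin d) → EReal) (β₂ β₃ μ : ℝ) (a b : ℕ → ℝ)
    (x₀ : EuclideanSpace ℝ (Fin d)) (q : Fin d → ℝ)
    (ξ : ℕ → Ξ) (w : ℕ → EuclideanSpace ℝ (Fin d)) (t : ℕ) : EuclideanSpace ℝ (Fin d) :=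
  gradEstimator F μ (run F h β₂ β₃ μ a b x₀ q ξ w t).x (ξ t) (w t)

lemma run_m_succ (t : ℕ) : (run F h β₂ β₃ μ a b x₀ q ξ w (t + 1)).m =
    b t • (run F h β₂ β₃ μ a b x₀ q ξ w t).m +
      (1 - b t) • runGrad F h β₂ β₃ μ a b x₀ q ξ w t := rfl

lemma run_v_le {G : ℝ} (hβ₂ : 0 ≤ β₂ ∧ β₂ ≤ 1)
    (hg : ∀ t, ‖runGrad F h β₂ β₃ μ a b x₀ q ξ w t‖ ≤ G) (t : ℕ) (i : Fin d) :
    (run F h β₂ β₃ μ a b x₀ q ξ w t).v i ≤ G ^ 2 := by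
  induction t with
  | zero => exact sq_nonneg G
  | succ t ih =>
    have e : (run F h β₂ β₃ μ a b x₀ q ξ w (t + 1)).v i =
      β₂ * (run F h β₂ β₃ μ a b x₀ q ξ w t).v i +
        (1 - β₂) * runGrad F h β₂ β₃ μ a b x₀ q ξ w t i ^ 2 := rfl
    have h1 : runGrad F h β₂ β₃ μ a b x₀ q ξ w t i ^ 2 ≤ G ^ 2 := by
      have h2 := (PiLp.norm_apply_le (runGrad F h β₂ β₃ μ a b x₀ q ξ w t) i).trans (hg t)
      rw [Real.norm_eq_abs] at h2
      exact sq_le_sq' (by linarith [abs_le.1 h2]) (le_of_abs_le h2)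
    have h2 := mul_le_mul_of_nonneg_left ih hβ₂.1
    have h3 := mul_le_mul_of_nonneg_left h1 (sub_nonneg.2 hβ₂.2)
    rw [e]
    linarith

lemma run_vhat_le {G Q : ℝ} (hβ₂ : 0 ≤ β₂ ∧ β₂ ≤ 1) (hβ₃ : 0 ≤ β₃ ∧ β₃ ≤ 1)
    (hg : ∀ t, ‖runGrad F h β₂ β₃ μ a b x₀ q ξ w t‖ ≤ G) (hq : ∀ i, q i ≤ Q) (t : ℕ)
    (i : Fin d) : (run F h β₂ β₃ μ a b x₀ q ξ w t).vhat i ≤ max Q (G ^ 2) := by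
  induction t with
  | zero => exact (hq i).trans (le_max_left _ _)
  | succ t ih =>
    set s := run F h β₂ β₃ μ a b x₀ q ξ w t with hs
    have e : (run F h β₂ β₃ μ a b x₀ q ξ w (t + 1)).vhat i = β₃ * s.vhat i +
      (1 - β₃) * max (s.vhat i) ((run F h β₂ β₃ μ a b x₀ q ξ w (t + 1)).v i) := rfl
    have h1 : max (s.vhat i) ((run F h β₂ β₃ μ a b x₀ q ξ w (t + 1)).v i) ≤ max Q (G ^ 2) :=
      max_le ih ((run_v_le hβ₂ hg (t + 1) i).trans (le_max_right _ _))
    have h2 := mul_le_mul_of_nonneg_left ih hβ₃.1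
    have h3 := mul_le_mul_of_nonneg_left h1 (sub_nonneg.2 hβ₃.2)
    rw [e]
    linarith

/-- The parameter b 0 = β₁/π may exceed 1, so the first update need not be an average. It starts
from m = 0, hence only |1 - b 0| ≤ 1 + b 0 ≤ B matters; later updates are averages. -/
lemma norm_run_m_le {G B : ℝ} (hG : 0 ≤ G) (hb : ∀ t, 0 ≤ b t) (hb1 : ∀ t, b (t + 1) ≤ 1)
    (hB : 1 + b 0 ≤ B) (hg : ∀ t, ‖runGrad F h β₂ β₃ μ a b x₀ q ξ w t‖ ≤ G) (t : ℕ) :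
    ‖(run F h β₂ β₃ μ a b x₀ q ξ w t).m‖ ≤ B * G := by
  have hB1 : 1 ≤ B := by linarith [hb 0]
  induction t with
  | zero =>
    have : (run F h β₂ β₃ μ a b x₀ q ξ w 0).m = 0 := rfl
    rw [this, norm_zero]
    positivity
  | succ t ih =>
    rw [run_m_succ]
    cases t with
    | zero =>
      have : (run F h β₂ β₃ μ a b x₀ q ξ w 0).m = 0 := rfl
      rw [this, smul_zero, zero_add, norm_smul]
      refine mul_le_mul ?_ (hg 0) (norm_nonneg _) (by linarith)
      rw [Real.norm_eq_abs, abs_le]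
      constructor <;> linarith [hb 0]
    | succ t =>
      refine (norm_add_le _ _).trans ?_
      rw [norm_smul, norm_smul, Real.norm_eq_abs, Real.norm_eq_abs, abs_of_nonneg (hb _),
        abs_of_nonneg (sub_nonneg.2 (hb1 t))]
      have h1 := mul_le_mul_of_nonneg_left ih (hb (t + 1))
      have h2 : ‖runGrad F h β₂ β₃ μ a b x₀ q ξ w (t + 1)‖ ≤ B * G :=
        (hg _).trans (le_mul_of_one_le_left hG hB1)
      have h3 := mul_le_mul_of_nonneg_left h2 (sub_nonneg.2 (hb1 t))
      linarith

/-! ### Measurability of the iterates -/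

variable [MeasurableSpace Ξ]

lemma measurable_run {D : ℝ} (hF : Measurable (Function.uncurry F)) (hh : ProxRegular h 0 D 0)
    (ha : ∀ t, 0 < a t) (hβ₃ : β₃ ≤ 1) (hq : ∀ i, 0 < q i) (t : ℕ) :
    Measurable (fun z : ℕ → Ξ × EuclideanSpace ℝ (Fin d) =>
      (run F h β₂ β₃ μ a b x₀ q (fun s => (z s).1) (fun s => (z s).2) t).x) ∧
    Measurable (fun z : ℕ → Ξ × EuclideanSpace ℝ (Fin d) =>
      (run F h β₂ β₃ μ a b x₀ q (fun s => (z s).1) (fun s => (z s).2) t).m) ∧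
    Measurable (fun z : ℕ → Ξ × EuclideanSpace ℝ (Fin d) =>
      (run F h β₂ β₃ μ a b x₀ q (fun s => (z s).1) (fun s => (z s).2) t).v) ∧
    Measurable (fun z : ℕ → Ξ × EuclideanSpace ℝ (Fin d) =>
      (run F h β₂ β₃ μ a b x₀ q (fun s => (z s).1) (fun s => (z s).2) t).vhat) := by
  induction t with
  | zero => exact ⟨measurable_const, measurable_const, measurable_const, measurable_const⟩
  | succ t ih =>
    obtain ⟨hx, hm, hv, hvh⟩ := ih
    set R := fun (z : ℕ → Ξ × EuclideanSpace ℝ (Fin d)) =>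
      run F h β₂ β₃ μ a b x₀ q (fun s => (z s).1) (fun s => (z s).2) with hR
    have hg : Measurable fun z : ℕ → Ξ × EuclideanSpace ℝ (Fin d) =>
        gradEstimator F μ (R z t).x (z t).1 (z t).2 :=
      (measurable_gradEstimator hF).comp
        (f := fun z : ℕ → Ξ × EuclideanSpace ℝ (Fin d) => ((R z t).x, ((z t).1, (z t).2)))
        (hx.prodMk (by fun_prop))
    have hm' : Measurable fun z => (R z (t + 1)).m :=
      (hm.const_smul (b t)).add (hg.const_smul (1 - b t))
    have hv' : Measurable fun z => (R z (t + 1)).v := by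
      refine measurable_pi_iff.2 fun i => ?_
      have h1 : Measurable fun z => (R z t).v i := (measurable_pi_apply i).comp hv
      have h2 : Measurable fun z : ℕ → Ξ × EuclideanSpace ℝ (Fin d) =>
          gradEstimator F μ (R z t).x (z t).1 (z t).2 i := by fun_prop
      exact (h1.const_mul β₂).add ((h2.pow_const 2).const_mul (1 - β₂))
    have hvh' : Measurable fun z => (R z (t + 1)).vhat := by
      refine measurable_pi_iff.2 fun i => ?_
      have h1 : Measurable fun z => (R z t).vhat i := (measurable_pi_apply i).comp hvh
      have h2 : Measurable fun z => (R z (t + 1)).v i := (measurable_pi_apply i).comp hv'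
      exact (h1.const_mul β₃).add ((h1.max h2).const_mul (1 - β₃))
    refine ⟨?_, hm', hv', hvh'⟩
    have hsq : Measurable fun z => fun i => √((R z (t + 1)).vhat i) :=
      measurable_pi_iff.2 fun i => ((measurable_pi_apply i).comp hvh').sqrt
    have hpt : Measurable fun z => (R z t).x -
        a t • WithLp.toLp 2 (fun i => (R z (t + 1)).m i / √((R z (t + 1)).vhat i)) := by
      refine hx.sub (Measurable.const_smul ?_ (a t))
      refine (WithLp.measurable_toLp 2 _).comp (measurable_pi_iff.2 fun i => ?_)
      have h1 : Measurable fun z => (R z (t + 1)).m i := by fun_prop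
      exact h1.div ((measurable_pi_apply i).comp hsq)
    have hpos : ∀ z i, 0 < √((R z (t + 1)).vhat i) := fun z i =>
      Real.sqrt_pos.2 ((hq i).trans_le (le_run_vhat hβ₃ (t + 1) i))
    exact hh.measurable_prox le_rfl (by have := ha t; positivity) hsq
      (fun z i => ⟨hpos z i, (hpos z i).le⟩) hpt

end Run

/-! ### Descent of the Moreau envelope along the iterations -/

section Descent

variable {d : ℕ} {Ξ : Type u} [MeasurableSpace Ξ] {P : Measure Ξ}
  {F : EuclideanSpace ℝ (Fin d) → Ξ → ℝ} {f h : EuclideanSpace ℝ (Fin d) → EReal}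
  {ρ : ℝ} {p : Fin d → ℝ} {L D μ : ℝ} {x : EuclideanSpace ℝ (Fin d)}
  {r : EuclideanSpace ℝ (Fin d) → ℝ} {w w' : Fin d → ℝ}

lemma one_div_two_mul_one_div (ρ : ℝ) : 1 / (2 * (1 / (2 * ρ))) = ρ := by
  rw [one_div, one_div, mul_inv, mul_inv, mul_inv, inv_inv, inv_inv, inv_mul_cancel_left₀ two_ne_zero]

/-- The preconditioner cancels the weights, leaving a Euclidean inner product. The last sum does not
depend on y and drops out when two points are compared. -/
lemma wnormSq_sub_smul_div {a : ℝ} (hw : ∀ i, 0 < w i) (x m y : EuclideanSpace ℝ (Fin d)) :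
    wnormSq w (x - a • WithLp.toLp 2 (fun i => m i / w i) - y) =
      wnormSq w (x - y) - 2 * a * inner ℝ m (x - y) + a ^ 2 * ∑ i, m i ^ 2 / w i := by
  simp only [wnormSq, PiLp.sub_apply, PiLp.smul_apply, smul_eq_mul, PiLp.inner_apply,
    Finset.mul_sum, ← Finset.sum_add_distrib, ← Finset.sum_sub_distrib, RCLike.inner_apply,
    conj_trivial]
  refine Finset.sum_congr rfl fun i _ => ?_
  have := (hw i).ne'
  field_simp
  ring

lemma wnormSq_sub_le_add {x y : EuclideanSpace ℝ (Fin d)} (hww : ∀ i, w i ≤ w' i)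
    (hxy : ∀ i, |x i - y i| ≤ D) :
    wnormSq w' (x - y) ≤ wnormSq w (x - y) + D ^ 2 * ∑ i, (w' i - w i) := by
  have h1 := wnormSq_le_of_abs_le (w := fun i => w' i - w i) (fun i => sub_nonneg.2 (hww i)) hxy
  have h2 : wnormSq (fun i => w' i - w i) (x - y) = wnormSq w' (x - y) - wnormSq w (x - y) := by
    simp only [wnormSq, ← Finset.sum_sub_distrib, sub_mul]
  linarith

lemma mul_le_of_quadratic {A c s : ℝ} (hc : 0 < c) : A * s - c / 8 * s ^ 2 ≤ 2 * A ^ 2 / c := by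
  rw [le_div_iff₀ hc]
  nlinarith [sq_nonneg (c * s - 4 * A)]

/-- One step of the algorithm decreases the envelope up to controlled errors. -/
lemma realEnvelope_step_le (hp : IsProblem P F f h ρ p L D μ) (hμ : 0 ≤ μ) (hρ : 0 < ρ)
    (hr : IsExtension P F f h L μ r) (hx : x ∈ effDom h) {a c : ℝ} (ha : 0 < a)
    (haρ : a * ρ ≤ 3 / 8) (hc : 0 < c) (hcw : ∀ i, c ≤ w i) (hpw : ∀ i, p i ≤ w i)
    (hww : ∀ i, w i ≤ w' i) (m : EuclideanSpace ℝ (Fin d)) :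
    realEnvelope (f + h) (1 / (2 * ρ)) (Matrix.diagonal w')
        (prox h a (Matrix.diagonal w') (x - a • WithLp.toLp 2 (fun i => m i / w' i))) ≤
      realEnvelope (f + h) (1 / (2 * ρ)) (Matrix.diagonal w) x +
      ρ * (D ^ 2 * ∑ i, (w' i - w i)) +
      2 * ρ * a * (r x - r (prox (f + h) (1 / (2 * ρ)) (Matrix.diagonal w) x) +
        inner ℝ m (prox (f + h) (1 / (2 * ρ)) (Matrix.diagonal w) x - x) -
        ρ * wnormSq w (x - prox (f + h) (1 / (2 * ρ)) (Matrix.diagonal w) x)) +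
      4 * ρ * a ^ 2 * (L + ‖m‖) ^ 2 / c := by
  have hψ := hr.proxRegular_add hp hμ hx
  have hh := hp.proxRegular_h hx
  have hdom := hr.effDom_add hp hμ
  have hw' : ∀ i, 0 < w' i := fun i => hc.trans_le ((hcw i).trans (hww i))
  set y := prox (f + h) (1 / (2 * ρ)) (Matrix.diagonal w) x with hy
  set xt := x - a • WithLp.toLp 2 (fun i => m i / w' i) with hxt
  set x' := prox h a (Matrix.diagonal w') xt with hx'
  have hyψ : y ∈ effDom (f + h) := hψ.prox_mem x
  have hym : y ∈ effDom h := hdom ▸ hyψ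
  have hxm : x' ∈ effDom h := hh.prox_mem xt
  have hxψ : x' ∈ effDom (f + h) := hdom.symm ▸ hxm
  -- The point y competes in the envelope at x' (`e2`) and in the step of h (`e4`); x' competes in
  -- the proximal problem of ψ at x (`e3`). The values of h cancel when these are combined.
  have e1 := hψ.realEnvelope_eq (ζ := 1 / (2 * ρ)) (w := w) x
  have e2 := hψ.realEnvelope_le (ζ := 1 / (2 * ρ)) (w := w') x' hyψ
  have e3 := hψ.prox_growth (ζ := 1 / (2 * ρ)) (by positivity) hpw x hxψ
  have e4 := hh.prox_growth (ζ := a) le_rfl (fun i => (hw' i).le) xt hym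
  rw [← hy, one_div_two_mul_one_div] at e1 e3
  rw [one_div_two_mul_one_div] at e2
  rw [← hx', sub_zero] at e4
  rw [hr.toReal_add hp hμ hym] at e1 e2 e3
  rw [hr.toReal_add hp hμ hxm] at e3
  rw [hxt, wnormSq_sub_smul_div hw', wnormSq_sub_smul_div hw'] at e4
  have e5 : 2 * a * (h x').toReal + wnormSq w' (x - x') - 2 * a * inner ℝ m (x - x') +
      wnormSq w' (y - x') ≤ 2 * a * (h y).toReal + wnormSq w' (x - y) -
        2 * a * inner ℝ m (x - y) := by
    have := mul_le_mul_of_nonneg_left e4 (show 0 ≤ 2 * a by positivity)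
    field_simp at this
    linarith
  have i1 : (inner ℝ m (x - y) : ℝ) = - inner ℝ m (y - x) := by
    rw [← inner_neg_right, neg_sub]
  have i2 : inner ℝ m (x - x') ≤ ‖m‖ * ‖x - x'‖ := real_inner_le_norm _ _
  have i3 : r x' - r x ≤ L * ‖x - x'‖ := by
    rw [norm_sub_rev]
    exact (le_abs_self _).trans (hr.lipschitz x' x)
  have i4 := wnormSq_sub_le_add (D := D) hww (hp.dom_bounded x hx y hym)
  have i5 := wnormSq_mono hww (x - x')
  have i6 := mul_norm_sq_le_wnormSq (fun i => (hcw i).trans (hww i)) (x - x')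
  have i7 := wnormSq_nonneg (fun i => (hc.trans_le (hcw i)).le) (x' - y)
  have i8 := wnormSq_nonneg (fun i => (hw' i).le) (x - x')
  -- Of the term ‖x - x'‖²/2 supplied by the step of h, the bound a ρ ≤ 3/8 uses up 3/8; the
  -- remaining 1/8 absorbs a(L + ‖m‖)‖x - x'‖.
  have q1 := mul_le_of_quadratic (A := a * (L + ‖m‖)) (s := ‖x - x'‖) hc
  have q2 : a * ρ * wnormSq w' (x - x') ≤ 3 / 8 * wnormSq w' (x - x') :=
    mul_le_mul_of_nonneg_right haρ i8
  -- bound for the increment that does not involve the values of `h`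
  have e6 : wnormSq w' (y - x') / 2 ≤ wnormSq w (x - y) / 2 + D ^ 2 * (∑ i, (w' i - w i)) / 2 +
      a * (r x - r y + inner ℝ m (y - x) - ρ * wnormSq w (x - y)) +
      2 * (a * (L + ‖m‖)) ^ 2 / c := by
    have j1 := mul_le_mul_of_nonneg_left e3 ha.le
    have j2 := mul_le_mul_of_nonneg_left i3 ha.le
    have j3 := mul_le_mul_of_nonneg_left i2 ha.le
    have j4 : a * (ρ * wnormSq w (x - x')) ≤ a * (ρ * wnormSq w' (x - x')) := by gcongr
    have j5 : 0 ≤ a * (ρ * wnormSq w (x' - y)) := by positivity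
    rw [i1] at e5
    linarith
  have e7 := mul_le_mul_of_nonneg_left e6 (show 0 ≤ 2 * ρ by positivity)
  have e8 : 2 * ρ * (2 * (a * (L + ‖m‖)) ^ 2 / c) = 4 * ρ * a ^ 2 * (L + ‖m‖) ^ 2 / c := by ring
  rw [wnormSq_sub_comm w' x' y] at e2
  rw [e1]
  linarith

/-- Comparison of the proximal displacements for two metrics. -/
lemma wnormSq_sub_prox_le (hp : IsProblem P F f h ρ p L D μ) (hμ : 0 ≤ μ) (hρ : 0 < ρ)
    (hr : IsExtension P F f h L μ r) (hx : x ∈ effDom h)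
    (hw : ∀ i, 0 ≤ w i) (hpw : ∀ i, p i ≤ w i) (hww : ∀ i, w i ≤ w' i) :
    wnormSq w' (x - prox (f + h) (1 / (2 * ρ)) (Matrix.diagonal w') x) ≤
      2 * wnormSq w (x - prox (f + h) (1 / (2 * ρ)) (Matrix.diagonal w) x) +
        6 * (D ^ 2 * ∑ i, (w' i - w i)) := by
  have hψ := hr.proxRegular_add hp hμ hx
  have hdom := hr.effDom_add hp hμ
  set y := prox (f + h) (1 / (2 * ρ)) (Matrix.diagonal w) x with hy
  set z := prox (f + h) (1 / (2 * ρ)) (Matrix.diagonal w') x with hz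
  have hyψ : y ∈ effDom (f + h) := hψ.prox_mem x
  have hzψ : z ∈ effDom (f + h) := hψ.prox_mem x
  have e1 := hψ.prox_growth (ζ := 1 / (2 * ρ)) (by positivity) hpw x hzψ
  have e2 := hψ.prox_growth (ζ := 1 / (2 * ρ)) (by positivity)
    (fun i => (hpw i).trans (hww i)) x hyψ
  rw [← hy, one_div_two_mul_one_div] at e1
  rw [← hz, one_div_two_mul_one_div] at e2
  have e3 := wnormSq_sub_le_add (D := D) hww (hp.dom_bounded x hx y (hdom ▸ hyψ))
  have e4 := wnormSq_mono hww (x - z)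
  have e5 := wnormSq_nonneg hw (z - y)
  -- In the sum of both growth inequalities ψ cancels; at z the metric change has a favourable sign,
  -- at y it costs D² times the trace increment.
  have e6 : wnormSq w' (y - z) ≤ 2 * (D ^ 2 * ∑ i, (w' i - w i)) := by
    have : ρ / 2 * wnormSq w' (y - z) ≤ ρ / 2 * (2 * (D ^ 2 * ∑ i, (w' i - w i))) := by
      have j1 := mul_le_mul_of_nonneg_left e3 hρ.le
      have j2 := mul_le_mul_of_nonneg_left e4 hρ.le
      have j3 := mul_nonneg (half_pos hρ).le e5
      linarith
    exact le_of_mul_le_mul_left this (half_pos hρ)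
  -- The factor 6 is 2 from returning x - y to the old metric plus 2 · 2 from `e6`.
  have e7 : wnormSq w' (x - z) ≤ 2 * wnormSq w' (x - y) + 2 * wnormSq w' (y - z) := by
    simp only [wnormSq, Finset.mul_sum, ← Finset.sum_add_distrib, PiLp.sub_apply]
    refine Finset.sum_le_sum fun i _ => ?_
    have h0 := mul_nonneg ((hw i).trans (hww i)) (sq_nonneg ((x i - y i) - (y i - z i)))
    linarith
  linarith

end Descent

/-! ### Integration of functions of independent variables -/

/-- Fubini for the product law; it takes the place of conditioning on the past. -/
lemma integral_comp_prodMk_of_indepFun {Ω A B : Type*} [MeasurableSpace Ω] [MeasurableSpace A]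
    [MeasurableSpace B] {Pr : Measure Ω} [IsProbabilityMeasure Pr] {X : Ω → A} {Z : Ω → B}
    (hX : Measurable X) (hZ : Measurable Z) (hXZ : IndepFun X Z Pr) {G : A × B → ℝ}
    (hG : Measurable G) (hint : Integrable (fun ω => G (X ω, Z ω)) Pr) :
    Integrable (fun ω => ∫ z, G (X ω, z) ∂(Pr.map Z)) Pr ∧
    ∫ ω, G (X ω, Z ω) ∂Pr = ∫ ω, ∫ z, G (X ω, z) ∂(Pr.map Z) ∂Pr := by
  have := Measure.isProbabilityMeasure_map (μ := Pr) hX.aemeasurable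
  have := Measure.isProbabilityMeasure_map (μ := Pr) hZ.aemeasurable
  have h1 := (indepFun_iff_map_prod_eq_prod_map_map hX.aemeasurable hZ.aemeasurable).1 hXZ
  have hint' : Integrable G ((Pr.map X).prod (Pr.map Z)) := by
    rw [← h1, integrable_map_measure hG.aestronglyMeasurable (hX.prodMk hZ).aemeasurable]
    exact hint
  have hi := hint'.integral_prod_left
  constructor
  · exact (integrable_map_measure hi.aestronglyMeasurable hX.aemeasurable).1 hi
  · rw [← integral_map hX.aemeasurable hi.aestronglyMeasurable, ← integral_prod _ hint', ← h1,
      integral_map (hX.prodMk hZ).aemeasurable hG.aestronglyMeasurable]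

/-! ### Summation along a sample path -/

/-- Conditions on the parameters of the algorithm. -/
structure Admissible {d : ℕ} (ρ β₂ β₃ B Sb qmin qmax a₀ : ℝ) (p q : Fin d → ℝ) (a b : ℕ → ℝ) :
    Prop where
  ρ_pos : 0 < ρ
  β₂_mem : 0 ≤ β₂ ∧ β₂ ≤ 1
  β₃_mem : 0 ≤ β₃ ∧ β₃ ≤ 1
  a_eq : ∀ t, a t = a₀
  a₀_pos : 0 < a₀
  a₀_mul_le : a₀ * ρ ≤ 3 / 8
  b_nonneg : ∀ t, 0 ≤ b t
  b_succ_le : ∀ t, b (t + 1) ≤ 1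
  b_zero_le : 1 + b 0 ≤ B
  b_sum_le : ∀ n, ∑ t ∈ Finset.range n, b t ≤ Sb
  qmin_pos : 0 < qmin
  q_mem : ∀ i, qmin ≤ q i ∧ q i ≤ qmax
  p_le : ∀ i, p i ≤ √(q i)

section Path

variable {d : ℕ} {Ξ : Type u}
  {F : EuclideanSpace ℝ (Fin d) → Ξ → ℝ} {f h : EuclideanSpace ℝ (Fin d) → EReal}
  {ρ β₂ β₃ B Sb qmin qmax a₀ : ℝ} {p q : Fin d → ℝ} {a b : ℕ → ℝ} {L D μ : ℝ}
  {x₀ : EuclideanSpace ℝ (Fin d)} {r : EuclideanSpace ℝ (Fin d) → ℝ}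
  {ξ : ℕ → Ξ} {w : ℕ → EuclideanSpace ℝ (Fin d)}

/-- The diagonal of `V̂_{t-1}^{1/2}` along a run. -/
noncomputable def runWeight (F : EuclideanSpace ℝ (Fin d) → Ξ → ℝ)
    (h : EuclideanSpace ℝ (Fin d) → EReal) (β₂ β₃ μ : ℝ) (a b : ℕ → ℝ)
    (x₀ : EuclideanSpace ℝ (Fin d)) (q : Fin d → ℝ)
    (ξ : ℕ → Ξ) (w : ℕ → EuclideanSpace ℝ (Fin d)) (t : ℕ) : Fin d → ℝ :=
  fun i => √((run F h β₂ β₃ μ a b x₀ q ξ w t).vhat i)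

/-- The proximal point of `ψ` at `x_t` in the metric `V̂_{s-1}^{1/2}`. -/
noncomputable def runProx (ψ : EuclideanSpace ℝ (Fin d) → EReal) (ρ : ℝ)
    (F : EuclideanSpace ℝ (Fin d) → Ξ → ℝ)
    (h : EuclideanSpace ℝ (Fin d) → EReal) (β₂ β₃ μ : ℝ) (a b : ℕ → ℝ)
    (x₀ : EuclideanSpace ℝ (Fin d)) (q : Fin d → ℝ)
    (ξ : ℕ → Ξ) (w : ℕ → EuclideanSpace ℝ (Fin d)) (s t : ℕ) : EuclideanSpace ℝ (Fin d) :=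
  prox ψ (1 / (2 * ρ)) (Matrix.diagonal (runWeight F h β₂ β₃ μ a b x₀ q ξ w s))
    (run F h β₂ β₃ μ a b x₀ q ξ w t).x

/-- The gap in the first-order convexity inequality for the gradient estimate of iteration `t`. -/
noncomputable def convexityGap (r : EuclideanSpace ℝ (Fin d) → ℝ) (ρ : ℝ) (p : Fin d → ℝ)
    (g x y : EuclideanSpace ℝ (Fin d)) : ℝ :=
  inner ℝ g (y - x) - (r y - r x + ρ / 2 * wnormSq p (y - x))

section

variable [MeasurableSpace Ξ] {P : Measure Ξ}

lemma runProx_mem (hp : IsProblem P F f h ρ p L D μ)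
    (hμ : 0 < μ) (hr : IsExtension P F f h L μ r) (hx₀ : x₀ ∈ effDom h) (s t : ℕ) :
    runProx (f + h) ρ F h β₂ β₃ μ a b x₀ q ξ w s t ∈ effDom h := by
  rw [← hr.effDom_add hp hμ.le]
  exact (hr.proxRegular_add hp hμ.le hx₀).prox_mem _

lemma norm_runGrad_le (hp : IsProblem P F f h ρ p L D μ) (hμ : 0 < μ) (hx₀ : x₀ ∈ effDom h)
    (hw : ∀ t, ‖w t‖ = 1) (t : ℕ) : ‖runGrad F h β₂ β₃ μ a b x₀ q ξ w t‖ ≤ d * L :=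
  norm_gradEstimator_le hp hμ (run_x_mem (hp.proxRegular_h hx₀) hx₀ t) _ (hw t)

lemma norm_sub_le_of_mem (hp : IsProblem P F f h ρ p L D μ) (hD : 0 ≤ D)
    {x y : EuclideanSpace ℝ (Fin d)} (hx : x ∈ effDom h) (hy : y ∈ effDom h) :
    ‖x - y‖ ≤ √d * D := by
  have h1 := norm_sub_sq_le_of_abs_le (hp.dom_bounded x hx y hy)
  refine abs_le_of_sq_le_sq' ?_ (by positivity) |>.2
  rwa [mul_pow, Real.sq_sqrt (Nat.cast_nonneg d)]

lemma le_moreauEnvelope {ψ : EuclideanSpace ℝ (Fin d) → EReal} {v : Fin d → ℝ} (hρ : 0 ≤ ρ)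
    (hv : ∀ i, 0 ≤ v i) (x : EuclideanSpace ℝ (Fin d)) :
    ⨅ y, ψ y ≤ moreauEnvelope ψ (1 / (2 * ρ)) (Matrix.diagonal v) x := by
  refine le_iInf fun y => (iInf_le _ y).trans ?_
  rw [proxObjective, one_div_two_mul_one_div, scaledNormSq_diagonal]
  refine le_add_of_nonneg_right ?_
  exact_mod_cast mul_nonneg hρ (wnormSq_nonneg hv _)

end

namespace Admissible

lemma q_pos (hA : Admissible ρ β₂ β₃ B Sb qmin qmax a₀ p q a b) (i : Fin d) : 0 < q i :=
  hA.qmin_pos.trans_le (hA.q_mem i).1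

lemma a_pos (hA : Admissible ρ β₂ β₃ B Sb qmin qmax a₀ p q a b) (t : ℕ) : 0 < a t := by
  rw [hA.a_eq]
  exact hA.a₀_pos

lemma sqrt_qmin_le (hA : Admissible ρ β₂ β₃ B Sb qmin qmax a₀ p q a b) (t : ℕ) (i : Fin d) :
    √qmin ≤ runWeight F h β₂ β₃ μ a b x₀ q ξ w t i :=
  Real.sqrt_le_sqrt ((hA.q_mem i).1.trans (le_run_vhat hA.β₃_mem.2 t i))

lemma runWeight_pos (hA : Admissible ρ β₂ β₃ B Sb qmin qmax a₀ p q a b) (t : ℕ) (i : Fin d) :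
    0 < runWeight F h β₂ β₃ μ a b x₀ q ξ w t i :=
  (Real.sqrt_pos.2 hA.qmin_pos).trans_le (hA.sqrt_qmin_le t i)

lemma le_runWeight (hA : Admissible ρ β₂ β₃ B Sb qmin qmax a₀ p q a b) (t : ℕ) (i : Fin d) :
    p i ≤ runWeight F h β₂ β₃ μ a b x₀ q ξ w t i :=
  (hA.p_le i).trans (Real.sqrt_le_sqrt (le_run_vhat hA.β₃_mem.2 t i))

lemma runWeight_le_succ (hA : Admissible ρ β₂ β₃ B Sb qmin qmax a₀ p q a b) (t : ℕ) (i : Fin d) :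
    runWeight F h β₂ β₃ μ a b x₀ q ξ w t i ≤ runWeight F h β₂ β₃ μ a b x₀ q ξ w (t + 1) i :=
  Real.sqrt_le_sqrt (run_vhat_le_succ hA.β₃_mem.2 t i)

variable [MeasurableSpace Ξ] {P : Measure Ξ}

/-- All squared gradient coordinates are at most (dL)², so vhat never exceeds the maximum of qmax
and (dL)². Summed over coordinates this gives a trace of order d². -/
lemma runWeight_le (hA : Admissible ρ β₂ β₃ B Sb qmin qmax a₀ p q a b)
    (hp : IsProblem P F f h ρ p L D μ) (hμ : 0 < μ) (hx₀ : x₀ ∈ effDom h)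
    (hL : 0 ≤ L) (hw : ∀ t, ‖w t‖ = 1) (t : ℕ) (i : Fin d) :
    runWeight F h β₂ β₃ μ a b x₀ q ξ w t i ≤ √qmax + d * L := by
  have h1 := run_vhat_le (ξ := ξ) (a := a) (b := b) hA.β₂_mem hA.β₃_mem
    (norm_runGrad_le hp hμ hx₀ hw) (fun i => (hA.q_mem i).2) t i
  have h2 : (0 : ℝ) ≤ d * L := by positivity
  refine (Real.sqrt_le_sqrt h1).trans ?_
  rcases le_total qmax ((d * L) ^ 2) with h3 | h3
  · rw [max_eq_right h3, Real.sqrt_sq h2]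
    linarith [Real.sqrt_nonneg qmax]
  · rw [max_eq_left h3]
    linarith

/-- Descent of the envelope in one iteration. -/
lemma envelope_descent (hA : Admissible ρ β₂ β₃ B Sb qmin qmax a₀ p q a b)
    (hp : IsProblem P F f h ρ p L D μ) (hμ : 0 < μ) (hr : IsExtension P F f h L μ r)
    (hx₀ : x₀ ∈ effDom h) (hL : 0 ≤ L) (hD : 0 ≤ D) (hw : ∀ t, ‖w t‖ = 1) (t : ℕ) :
    ρ ^ 2 * a₀ * wnormSq (runWeight F h β₂ β₃ μ a b x₀ q ξ w t)
        ((run F h β₂ β₃ μ a b x₀ q ξ w t).x - runProx (f + h) ρ F h β₂ β₃ μ a b x₀ q ξ w t t) ≤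
      (realEnvelope (f + h) (1 / (2 * ρ)) (Matrix.diagonal (runWeight F h β₂ β₃ μ a b x₀ q ξ w t))
          (run F h β₂ β₃ μ a b x₀ q ξ w t).x -
        realEnvelope (f + h) (1 / (2 * ρ))
          (Matrix.diagonal (runWeight F h β₂ β₃ μ a b x₀ q ξ w (t + 1)))
          (run F h β₂ β₃ μ a b x₀ q ξ w (t + 1)).x) +
      ρ * D ^ 2 * (∑ i, runWeight F h β₂ β₃ μ a b x₀ q ξ w (t + 1) i -
        ∑ i, runWeight F h β₂ β₃ μ a b x₀ q ξ w t i) +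
      2 * ρ * a₀ * convexityGap r ρ p (runGrad F h β₂ β₃ μ a b x₀ q ξ w t)
        (run F h β₂ β₃ μ a b x₀ q ξ w t).x (runProx (f + h) ρ F h β₂ β₃ μ a b x₀ q ξ w t t) +
      2 * ρ * a₀ * (2 * B * (d * L) * (√d * D)) * b t +
      4 * ρ * a₀ ^ 2 * (L + B * (d * L)) ^ 2 / √qmin := by
  set x := (run F h β₂ β₃ μ a b x₀ q ξ w t).x with hx
  set y := runProx (f + h) ρ F h β₂ β₃ μ a b x₀ q ξ w t t with hy
  set g := runGrad F h β₂ β₃ μ a b x₀ q ξ w t with hg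
  set m := (run F h β₂ β₃ μ a b x₀ q ξ w t).m with hm
  set m' := (run F h β₂ β₃ μ a b x₀ q ξ w (t + 1)).m with hm'
  have hρ := hA.ρ_pos
  have ha₀ := hA.a₀_pos
  have hG : (0 : ℝ) ≤ d * L := by positivity
  have hB1 : 1 ≤ B := by linarith [hA.b_zero_le, hA.b_nonneg 0]
  have hxm : x ∈ effDom h := run_x_mem (hp.proxRegular_h hx₀) hx₀ t
  have hym : y ∈ effDom h := runProx_mem hp hμ hr hx₀ t t
  have hgn := norm_runGrad_le (β₂ := β₂) (β₃ := β₃) (a := a) (b := b) (q := q) (ξ := ξ) hp hμ hx₀ hw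
  have hmn := norm_run_m_le hG hA.b_nonneg hA.b_succ_le hA.b_zero_le hgn
  have hc : 0 < √qmin := Real.sqrt_pos.2 hA.qmin_pos
  have key := realEnvelope_step_le (a := a t) hp hμ.le hρ hr hxm (hA.a_pos t)
    (by rw [hA.a_eq]; exact hA.a₀_mul_le) hc
    (hA.sqrt_qmin_le (F := F) (h := h) (μ := μ) (x₀ := x₀) (ξ := ξ) (w := w) t)
    (hA.le_runWeight t) (hA.runWeight_le_succ t) m'
  have hstep : (run F h β₂ β₃ μ a b x₀ q ξ w (t + 1)).x =
      prox h (a t) (Matrix.diagonal (runWeight F h β₂ β₃ μ a b x₀ q ξ w (t + 1)))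
        (x - a t • WithLp.toLp 2 (fun i => m' i / runWeight F h β₂ β₃ μ a b x₀ q ξ w (t + 1) i)) :=
    rfl
  have hy' : prox (f + h) (1 / (2 * ρ)) (Matrix.diagonal (runWeight F h β₂ β₃ μ a b x₀ q ξ w t)) x
      = y := rfl
  rw [← hstep, hy', hA.a_eq, Finset.sum_sub_distrib] at key
  -- The momentum direction is the fresh gradient plus b_t times a bounded vector, so its error is
  -- summable.
  have hmd : (inner ℝ m' (y - x) : ℝ) = inner ℝ g (y - x) + b t * inner ℝ (m - g) (y - x) := by
    rw [hm', run_m_succ, ← hm, ← hg, inner_add_left, inner_smul_left, inner_smul_left,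
      inner_sub_left]
    simp only [conj_trivial]
    ring
  have hmb : b t * inner ℝ (m - g) (y - x) ≤ b t * (2 * B * (d * L) * (√d * D)) := by
    refine mul_le_mul_of_nonneg_left ?_ (hA.b_nonneg t)
    refine (real_inner_le_norm _ _).trans (mul_le_mul ?_ (norm_sub_le_of_mem hp hD hym hxm)
      (norm_nonneg _) (by positivity))
    have := le_mul_of_one_le_left hG hB1
    linarith [norm_sub_le m g, hmn t, hgn t]
  have hsq : 4 * ρ * a₀ ^ 2 * (L + ‖m'‖) ^ 2 / √qmin ≤
      4 * ρ * a₀ ^ 2 * (L + B * (d * L)) ^ 2 / √qmin := by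
    gcongr
    exact hmn (t + 1)
  -- Weak convexity of f costs half of the available ρ ‖x - y‖², since p lies below the weights. The
  -- other half, times 2ρ a₀, is the coefficient ρ² a₀.
  have hpw : ρ / 2 * wnormSq p (y - x) ≤
      ρ / 2 * wnormSq (runWeight F h β₂ β₃ μ a b x₀ q ξ w t) (x - y) := by
    rw [wnormSq_sub_comm p]
    exact mul_le_mul_of_nonneg_left (wnormSq_mono (hA.le_runWeight t) _) (by positivity)
  have h1 : 2 * ρ * a₀ * (r x - r y + inner ℝ m' (y - x) -
      ρ * wnormSq (runWeight F h β₂ β₃ μ a b x₀ q ξ w t) (x - y)) ≤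
      2 * ρ * a₀ * (convexityGap r ρ p g x y + b t * (2 * B * (d * L) * (√d * D)) -
        ρ / 2 * wnormSq (runWeight F h β₂ β₃ μ a b x₀ q ξ w t) (x - y)) := by
    refine mul_le_mul_of_nonneg_left ?_ (by positivity)
    rw [convexityGap, hmd]
    linarith
  linarith

/-- The sum of the squared proximal displacements along a sample path. -/
lemma sum_wnormSq_le (hA : Admissible ρ β₂ β₃ B Sb qmin qmax a₀ p q a b)
    (hp : IsProblem P F f h ρ p L D μ) (hμ : 0 < μ) (hr : IsExtension P F f h L μ r)
    (hx₀ : x₀ ∈ effDom h) (hL : 0 ≤ L) (hD : 0 ≤ D) (hw : ∀ t, ‖w t‖ = 1) {Δ : ℝ}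
    (hΔ : moreauEnvelope (f + h) (1 / (2 * ρ)) (sqrtDiag q) x₀ ≤ (⨅ x, (f + h) x) + (Δ : EReal))
    (n : ℕ) :
    ∑ t ∈ Finset.range n, wnormSq (runWeight F h β₂ β₃ μ a b x₀ q ξ w (t + 1))
        ((run F h β₂ β₃ μ a b x₀ q ξ w t).x -
          runProx (f + h) ρ F h β₂ β₃ μ a b x₀ q ξ w (t + 1) t) ≤
      2 / (ρ ^ 2 * a₀) * (Δ + ρ * D ^ 2 * (d * (√qmax + d * L)) +
        2 * ρ * a₀ * (2 * B * (d * L) * (√d * D)) * Sb +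
        n * (4 * ρ * a₀ ^ 2 * (L + B * (d * L)) ^ 2 / √qmin)) +
      6 * (D ^ 2 * (d * (√qmax + d * L))) +
      4 / ρ * ∑ t ∈ Finset.range n, convexityGap r ρ p (runGrad F h β₂ β₃ μ a b x₀ q ξ w t)
        (run F h β₂ β₃ μ a b x₀ q ξ w t).x
        (runProx (f + h) ρ F h β₂ β₃ μ a b x₀ q ξ w t t) := by
  have hρ := hA.ρ_pos
  have ha₀ := hA.a₀_pos
  have hB1 : 1 ≤ B := by linarith [hA.b_zero_le, hA.b_nonneg 0]
  have hψ := hr.proxRegular_add hp hμ.le hx₀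
  set W : ℕ → ℝ := fun t => ∑ i, runWeight F h β₂ β₃ μ a b x₀ q ξ w t i with hW
  set E : ℕ → ℝ := fun t => realEnvelope (f + h) (1 / (2 * ρ))
    (Matrix.diagonal (runWeight F h β₂ β₃ μ a b x₀ q ξ w t))
    (run F h β₂ β₃ μ a b x₀ q ξ w t).x with hE
  set N : ℕ → ℝ := fun t => convexityGap r ρ p (runGrad F h β₂ β₃ μ a b x₀ q ξ w t)
    (run F h β₂ β₃ μ a b x₀ q ξ w t).x (runProx (f + h) ρ F h β₂ β₃ μ a b x₀ q ξ w t t) with hN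
  set U : ℕ → ℝ := fun t => wnormSq (runWeight F h β₂ β₃ μ a b x₀ q ξ w t)
    ((run F h β₂ β₃ μ a b x₀ q ξ w t).x - runProx (f + h) ρ F h β₂ β₃ μ a b x₀ q ξ w t t) with hU
  set Y : ℕ → ℝ := fun t => wnormSq (runWeight F h β₂ β₃ μ a b x₀ q ξ w (t + 1))
    ((run F h β₂ β₃ μ a b x₀ q ξ w t).x - runProx (f + h) ρ F h β₂ β₃ μ a b x₀ q ξ w (t + 1) t)
    with hY
  have hW0 : ∀ t, 0 ≤ W t := fun t => Finset.sum_nonneg fun i _ => (hA.runWeight_pos t i).le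
  have hWn : W n - W 0 ≤ d * (√qmax + d * L) := by
    have : W n ≤ ∑ _i : Fin d, (√qmax + d * L) :=
      Finset.sum_le_sum fun i _ => hA.runWeight_le hp hμ hx₀ hL hw n i
    rw [Finset.sum_const, Finset.card_univ, Fintype.card_fin, nsmul_eq_mul] at this
    linarith [hW0 0]
  have hEn : E 0 - E n ≤ Δ := by
    have h1 : (E 0 : EReal) ≤ (⨅ x, (f + h) x) + (Δ : EReal) := by
      rw [hE]
      simp only
      rw [hψ.coe_realEnvelope]
      exact hΔ
    have h2 : ⨅ x, (f + h) x ≤ (E n : EReal) := by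
      rw [hE]
      simp only
      rw [hψ.coe_realEnvelope]
      exact le_moreauEnvelope hρ.le (fun i => (hA.runWeight_pos n i).le) _
    have h3 : (E 0 : EReal) ≤ ((E n + Δ : ℝ) : EReal) := by
      rw [EReal.coe_add]
      exact h1.trans (add_le_add h2 le_rfl)
    linarith [EReal.coe_le_coe_iff.1 h3]
  have hsum : ρ ^ 2 * a₀ * ∑ t ∈ Finset.range n, U t ≤ (E 0 - E n) + ρ * D ^ 2 * (W n - W 0) +
      2 * ρ * a₀ * ∑ t ∈ Finset.range n, N t +
      2 * ρ * a₀ * (2 * B * (d * L) * (√d * D)) * ∑ t ∈ Finset.range n, b t +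
      n * (4 * ρ * a₀ ^ 2 * (L + B * (d * L)) ^ 2 / √qmin) := by
    have h1 := Finset.sum_le_sum fun t (_ : t ∈ Finset.range n) =>
      hA.envelope_descent (ξ := ξ) hp hμ hr hx₀ hL hD hw t
    rw [← Finset.mul_sum] at h1
    refine h1.trans (le_of_eq ?_)
    simp only [Finset.sum_add_distrib, ← Finset.mul_sum, Finset.sum_const, Finset.card_range,
      nsmul_eq_mul]
    rw [Finset.sum_range_sub' E n, Finset.sum_range_sub W n]
  have hbs : 2 * ρ * a₀ * (2 * B * (d * L) * (√d * D)) * ∑ t ∈ Finset.range n, b t ≤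
      2 * ρ * a₀ * (2 * B * (d * L) * (√d * D)) * Sb :=
    mul_le_mul_of_nonneg_left (hA.b_sum_le n) (by positivity)
  have hWn' : ρ * D ^ 2 * (W n - W 0) ≤ ρ * D ^ 2 * (d * (√qmax + d * L)) :=
    mul_le_mul_of_nonneg_left hWn (by positivity)
  -- Passage from the metric W_t of the descent to the metric W_{t+1} of the claimed gradient.
  have hYU : ∑ t ∈ Finset.range n, Y t ≤ 2 * ∑ t ∈ Finset.range n, U t +
      6 * (D ^ 2 * (W n - W 0)) := by
    rw [← Finset.sum_range_sub W n, Finset.mul_sum, Finset.mul_sum, Finset.mul_sum,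
      ← Finset.sum_add_distrib]
    refine Finset.sum_le_sum fun t _ => ?_
    have := wnormSq_sub_prox_le hp hμ.le hρ hr
      (run_x_mem (β₂ := β₂) (β₃ := β₃) (a := a) (b := b) (q := q) (ξ := ξ) (w := w) (μ := μ)
        (F := F) (hp.proxRegular_h hx₀) hx₀ t)
      (fun i => (hA.runWeight_pos (F := F) (h := h) (μ := μ) (x₀ := x₀) (ξ := ξ) (w := w) t i).le)
      (hA.le_runWeight t) (hA.runWeight_le_succ t)
    rw [Finset.sum_sub_distrib] at this
    exact this
  have hU2 : ∑ t ∈ Finset.range n, U t ≤ 1 / (ρ ^ 2 * a₀) *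
      (Δ + ρ * D ^ 2 * (d * (√qmax + d * L)) +
        2 * ρ * a₀ * (2 * B * (d * L) * (√d * D)) * Sb +
        n * (4 * ρ * a₀ ^ 2 * (L + B * (d * L)) ^ 2 / √qmin)) +
      2 / ρ * ∑ t ∈ Finset.range n, N t := by
    have h0 : 0 < ρ ^ 2 * a₀ := by positivity
    refine le_of_mul_le_mul_left ?_ h0
    have e1 : ρ ^ 2 * a₀ * (2 / ρ * ∑ t ∈ Finset.range n, N t) =
        2 * ρ * a₀ * ∑ t ∈ Finset.range n, N t := by
      field_simp
    rw [mul_add, e1, ← mul_assoc, mul_one_div_cancel h0.ne', one_mul]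
    linarith
  have hDW : D ^ 2 * (W n - W 0) ≤ D ^ 2 * (d * (√qmax + d * L)) :=
    mul_le_mul_of_nonneg_left hWn (by positivity)
  have e2 : ∀ X S : ℝ, 2 * (1 / (ρ ^ 2 * a₀) * X + 2 / ρ * S) = 2 / (ρ ^ 2 * a₀) * X + 4 / ρ * S := by
    intro X S
    ring
  have h3 := mul_le_mul_of_nonneg_left hU2 (zero_le_two (α := ℝ))
  rw [e2] at h3
  linarith

end Admissible

end Path

/-! ### Independence -/

section Independence

variable {Ω : Type*} [MeasurableSpace Ω] {Pr : Measure Ω} [IsProbabilityMeasure Pr]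

/-- A function of the first `t` of a sequence of independent variables is independent of the
variable number `t`. -/
lemma indepFun_of_eq_of_forall_lt {Z A : Type*} [MeasurableSpace Z] [MeasurableSpace A]
    {ζ : ℕ → Ω → Z} (hζ : ∀ t, Measurable (ζ t)) (hind : iIndepFun ζ Pr)
    {X : (ℕ → Z) → A} (hX : Measurable X) {t : ℕ}
    (hdep : ∀ z z' : ℕ → Z, (∀ s < t, z s = z' s) → X z = X z') :
    IndepFun (fun ω => X fun s => ζ s ω) (ζ t) Pr := by
  obtain ⟨ω₀⟩ := nonempty_of_isProbabilityMeasure Pr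
  -- A finite history is padded to a full sequence by the values at a fixed outcome; the padding
  -- does not affect X.
  set e : (Finset.range t → Z) → ℕ → Z := fun y s =>
    if hs : s ∈ Finset.range t then y ⟨s, hs⟩ else ζ s ω₀ with he
  have hem : Measurable e := by
    refine measurable_pi_iff.2 fun s => ?_
    by_cases hs : s ∈ Finset.range t
    · simp only [he, hs, dif_pos]
      exact measurable_pi_apply _
    · simp only [he, hs, dif_neg, not_false_eq_true]
      exact measurable_const
  have h1 := hind.indepFun_finset (Finset.range t) {t} (by simp) hζ
  have h2 := h1.comp (φ := fun y => X (e y))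
    (ψ := fun y => y ⟨t, Finset.mem_singleton_self t⟩) (hX.comp hem)
    (measurable_pi_apply (X := fun _ : ({t} : Finset ℕ) => Z) ⟨t, Finset.mem_singleton_self t⟩)
  have h3 : ((fun y => X (e y)) ∘ fun ω (i : Finset.range t) => ζ i ω) =
      fun ω => X fun s => ζ s ω := by
    funext ω
    refine hdep _ _ fun s hs => ?_
    simp [he, hs]
  rw [h3] at h2
  exact h2

/-- The expectation at an independent uniformly distributed random index. -/
lemma integral_uniform_index {B : Type*} [MeasurableSpace B] {τ : Ω → ℕ} (hτ : Measurable τ)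
    {V : Ω → B} (hV : Measurable V) (hτV : IndepFun τ V Pr) {n : ℕ} (hn : 0 < n)
    (hlaw : ∀ t < n, Pr {ω | τ ω = t} = ENNReal.ofReal (1 / n)) {X : ℕ → B → ℝ}
    (hX : ∀ t, Measurable (X t)) (hint : ∀ t, Integrable (fun ω => X t (V ω)) Pr) :
    Integrable (fun ω => X (τ ω) (V ω)) Pr ∧
      ∫ ω, X (τ ω) (V ω) ∂Pr = 1 / n * ∑ t ∈ Finset.range n, ∫ ω, X t (V ω) ∂Pr := by
  set I : ℕ → Ω → ℝ := fun t ω => ({t} : Set ℕ).indicator (fun _ => (1 : ℝ)) (τ ω) with hI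
  have hIm : ∀ t, Measurable (I t) := fun t =>
    (measurable_const.indicator (measurableSet_singleton t)).comp hτ
  have hset : ∀ t, MeasurableSet {ω | τ ω = t} := fun t => hτ (measurableSet_singleton t)
  -- The prescribed probabilities already sum to one, so larger indices have probability zero.
  have hmem : ∀ᵐ ω ∂Pr, τ ω < n := by
    have hm : MeasurableSet {ω | τ ω < n} := hτ measurableSet_Iio
    refine (mem_ae_iff_prob_eq_one hm).2 ?_
    have hU : {ω | τ ω < n} = ⋃ t ∈ Finset.range n, {ω | τ ω = t} := by
      ext ω
      simp
    have hn' : (n : ℝ) ≠ 0 := Nat.cast_ne_zero.2 hn.ne'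
    rw [hU, measure_biUnion_finset (fun s _ t _ hst => ?_) fun t _ => hset t,
      Finset.sum_congr rfl fun t ht => hlaw t (Finset.mem_range.1 ht), Finset.sum_const,
      Finset.card_range, nsmul_eq_mul, ← ENNReal.ofReal_natCast, ← ENNReal.ofReal_mul (by positivity),
      mul_one_div_cancel hn', ENNReal.ofReal_one]
    exact Set.disjoint_left.2 fun ω hs ht => hst (hs.symm.trans ht)
  have hII : ∀ t < n, ∫ ω, I t ω ∂Pr = 1 / n := by
    intro t ht
    have : I t = {ω | τ ω = t}.indicator fun _ => (1 : ℝ) := by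
      funext ω
      by_cases h : τ ω = t <;> simp [hI, h]
    rw [this, integral_indicator_const _ (hset t), Measure.real, hlaw t ht,
      ENNReal.toReal_ofReal (by positivity), smul_eq_mul, mul_one]
  have hprod : ∀ t, Integrable (fun ω => I t ω * X t (V ω)) Pr := fun t =>
    (hint t).bdd_mul (c := 1) (hIm t).aestronglyMeasurable (Eventually.of_forall fun ω => by
      by_cases h : τ ω = t <;> simp [hI, h])
  have heq : (fun ω => X (τ ω) (V ω)) =ᵐ[Pr]
      fun ω => ∑ t ∈ Finset.range n, I t ω * X t (V ω) := by
    filter_upwards [hmem] with ω hω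
    rw [Finset.sum_eq_single_of_mem (τ ω) (Finset.mem_range.2 hω)]
    · simp [hI]
    · intro t _ ht
      simp [hI, ht.symm]
  constructor
  · exact (integrable_finsetSum _ fun t _ => hprod t).congr heq.symm
  · rw [integral_congr_ae heq, integral_finsetSum _ fun t _ => hprod t, Finset.mul_sum]
    refine Finset.sum_congr rfl fun t ht => ?_
    have hi : IndepFun (I t) (fun ω => X t (V ω)) Pr :=
      hτV.comp (measurable_const.indicator (measurableSet_singleton t)) (hX t)
    rw [hi.integral_fun_mul_eq_mul_integral (hIm t).aestronglyMeasurable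
      ((hX t).comp hV).aestronglyMeasurable, hII t (Finset.mem_range.1 ht)]

end Independence

/-! ### Expectations along the algorithm -/

section Expectation

variable {d : ℕ} {Ξ : Type u} [MeasurableSpace Ξ] {P : Measure Ξ}
  {F : EuclideanSpace ℝ (Fin d) → Ξ → ℝ} {f h : EuclideanSpace ℝ (Fin d) → EReal}
  {ρ β₂ β₃ B Sb qmin qmax a₀ : ℝ} {p q : Fin d → ℝ} {a b : ℕ → ℝ} {L D μ : ℝ}
  {x₀ : EuclideanSpace ℝ (Fin d)} {r : EuclideanSpace ℝ (Fin d) → ℝ}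

lemma measurable_runWeight (hA : Admissible ρ β₂ β₃ B Sb qmin qmax a₀ p q a b)
    (hp : IsProblem P F f h ρ p L D μ) (hx₀ : x₀ ∈ effDom h) (t : ℕ) :
    Measurable fun z : ℕ → Ξ × EuclideanSpace ℝ (Fin d) =>
      runWeight F h β₂ β₃ μ a b x₀ q (fun s => (z s).1) (fun s => (z s).2) t :=
  measurable_pi_iff.2 fun i => ((measurable_pi_apply i).comp
    (measurable_run hp.F_measurable (hp.proxRegular_h hx₀) hA.a_pos hA.β₃_mem.2 hA.q_pos
      t).2.2.2).sqrt

lemma measurable_run_x (hA : Admissible ρ β₂ β₃ B Sb qmin qmax a₀ p q a b)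
    (hp : IsProblem P F f h ρ p L D μ) (hx₀ : x₀ ∈ effDom h) (t : ℕ) :
    Measurable fun z : ℕ → Ξ × EuclideanSpace ℝ (Fin d) =>
      (run F h β₂ β₃ μ a b x₀ q (fun s => (z s).1) (fun s => (z s).2) t).x :=
  (measurable_run hp.F_measurable (hp.proxRegular_h hx₀) hA.a_pos hA.β₃_mem.2 hA.q_pos t).1

lemma measurable_runProx (hA : Admissible ρ β₂ β₃ B Sb qmin qmax a₀ p q a b)
    (hp : IsProblem P F f h ρ p L D μ) (hμ : 0 < μ) (hr : IsExtension P F f h L μ r)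
    (hx₀ : x₀ ∈ effDom h) (s t : ℕ) :
    Measurable fun z : ℕ → Ξ × EuclideanSpace ℝ (Fin d) =>
      runProx (f + h) ρ F h β₂ β₃ μ a b x₀ q (fun s => (z s).1) (fun s => (z s).2) s t := by
  have hρ := hA.ρ_pos
  refine (hr.proxRegular_add hp hμ.le hx₀).measurable_prox (by positivity) ?_
    (measurable_runWeight hA hp hx₀ s) (fun z i => ⟨hA.runWeight_pos s i, hA.le_runWeight s i⟩)
    (measurable_run_x hA hp hx₀ t)
  rw [one_div_two_mul_one_div]
  linarith

lemma measurable_convexityGap {A : Type*} [MeasurableSpace A] (hr : Continuous r)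
    {g x y : A → EuclideanSpace ℝ (Fin d)} (hg : Measurable g) (hx : Measurable x)
    (hy : Measurable y) : Measurable fun ω => convexityGap r ρ p (g ω) (x ω) (y ω) := by
  have h1 := (continuous_wnormSq p).measurable
  have h2 := hr.measurable
  unfold convexityGap
  exact (hg.inner (hy.sub hx)).sub (((h2.comp hy).sub (h2.comp hx)).add
    ((h1.comp (hy.sub hx)).const_mul _))

/-- Serves integrability only; its dependence on p does not reach the rate. -/
lemma abs_convexityGap_le (hp : IsProblem P F f h ρ p L D μ) (hr : IsExtension P F f h L μ r)
    (hρ : 0 ≤ ρ) (hL : 0 ≤ L) (hD : 0 ≤ D) {G : ℝ} {g x y : EuclideanSpace ℝ (Fin d)}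
    (hg : ‖g‖ ≤ G) (hx : x ∈ effDom h) (hy : y ∈ effDom h) :
    |convexityGap r ρ p g x y| ≤
      G * (√d * D) + (L * (√d * D) + ρ / 2 * (D ^ 2 * ∑ i, p i)) := by
  have hG : 0 ≤ G := (norm_nonneg _).trans hg
  have hn := norm_sub_le_of_mem hp hD hy hx
  have h1 : |(inner ℝ g (y - x) : ℝ)| ≤ G * (√d * D) :=
    (abs_real_inner_le_norm _ _).trans (mul_le_mul hg hn (norm_nonneg _) hG)
  have h2 : |r y - r x| ≤ L * (√d * D) :=
    (hr.lipschitz y x).trans (mul_le_mul_of_nonneg_left hn hL)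
  have hp0 : ∀ i, 0 ≤ p i := fun i => (hp.p_pos i).le
  have h3 : |ρ / 2 * wnormSq p (y - x)| ≤ ρ / 2 * (D ^ 2 * ∑ i, p i) := by
    rw [abs_of_nonneg (mul_nonneg (by positivity) (wnormSq_nonneg hp0 _))]
    exact mul_le_mul_of_nonneg_left (wnormSq_le_of_abs_le hp0 (hp.dom_bounded y hy x hx))
      (by positivity)
  exact (abs_sub _ _).trans (add_le_add h1 ((abs_add_le _ _).trans (add_le_add h2 h3)))

lemma integral_convexityGap_gradEstimator_le [NeZero d] [IsProbabilityMeasure P]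
    (hp : IsProblem P F f h ρ p L D μ) (hμ : 0 < μ) (hρ : 0 ≤ ρ) (hr : IsExtension P F f h L μ r)
    {x y : EuclideanSpace ℝ (Fin d)} (hx : x ∈ effDom h) (hy : y ∈ effDom h) :
    ∫ z, convexityGap r ρ p (gradEstimator F μ x z.1 z.2) x y ∂P.prod (sphereUniform d) ≤
      2 * (L * μ) := by
  have := isProbabilityMeasure_sphereUniform (d := d)
  have hgi := integrable_inner_gradEstimator hp hμ hx y
  have key := integral_inner_gradEstimator_le hp hμ hρ hr hx hy
  simp only [convexityGap]
  rw [integral_sub hgi (integrable_const _), integral_const, probReal_univ, one_smul]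
  linarith

variable {Ω : Type v} [MeasurableSpace Ω] {Pr : Measure Ω}
  {T : ℕ} {ξ : ℕ → Ω → Ξ} {w : ℕ → Ω → EuclideanSpace ℝ (Fin d)} {τ : Ω → ℕ}

lemma IsSampling.ae_norm_eq_one [IsProbabilityMeasure P] (hS : IsSampling P Pr a T ξ w τ) :
    ∀ᵐ ω ∂Pr, ∀ t, ‖w t ω‖ = 1 := by
  rw [ae_all_iff]
  intro t
  have hae : ∀ᵐ z ∂Pr.map (fun ω => (ξ t ω, w t ω)), ‖z.2‖ = 1 := by
    rw [hS.law t]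
    exact Measure.quasiMeasurePreserving_snd.ae ae_sphereUniform
  exact ae_of_ae_map ((hS.measurable_ξ t).prodMk (hS.measurable_w t)).aemeasurable hae

lemma IsSampling.measurable_samples (hS : IsSampling P Pr a T ξ w τ) :
    Measurable fun ω => fun t => (ξ t ω, w t ω) :=
  measurable_pi_iff.2 fun t => (hS.measurable_ξ t).prodMk (hS.measurable_w t)

variable [IsProbabilityMeasure Pr]

/-- The gradient estimates satisfy the first-order convexity inequality in expectation, up to the
smoothing bias. -/
lemma integral_convexityGap_le [NeZero d] [IsProbabilityMeasure P]
    (hA : Admissible ρ β₂ β₃ B Sb qmin qmax a₀ p q a b)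
    (hp : IsProblem P F f h ρ p L D μ) (hμ : 0 < μ) (hr : IsExtension P F f h L μ r)
    (hx₀ : x₀ ∈ effDom h) (hS : IsSampling P Pr a T ξ w τ) (t : ℕ) :
    Integrable (fun ω => convexityGap r ρ p
      (runGrad F h β₂ β₃ μ a b x₀ q (fun s => ξ s ω) (fun s => w s ω) t)
      (run F h β₂ β₃ μ a b x₀ q (fun s => ξ s ω) (fun s => w s ω) t).x
      (runProx (f + h) ρ F h β₂ β₃ μ a b x₀ q (fun s => ξ s ω) (fun s => w s ω) t t)) Pr ∧
    ∫ ω, convexityGap r ρ p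
      (runGrad F h β₂ β₃ μ a b x₀ q (fun s => ξ s ω) (fun s => w s ω) t)
      (run F h β₂ β₃ μ a b x₀ q (fun s => ξ s ω) (fun s => w s ω) t).x
      (runProx (f + h) ρ F h β₂ β₃ μ a b x₀ q (fun s => ξ s ω) (fun s => w s ω) t t) ∂Pr
      ≤ 2 * (L * μ) := by
  have := isProbabilityMeasure_sphereUniform (d := d)
  have hρ := hA.ρ_pos
  have hL := hp.lipschitzConst_nonneg hμ hx₀
  have hD := hp.diam_nonneg hx₀
  set Z : ℕ → Ω → Ξ × EuclideanSpace ℝ (Fin d) := fun s ω => (ξ s ω, w s ω) with hZ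
  have hZm : ∀ s, Measurable (Z s) := fun s => (hS.measurable_ξ s).prodMk (hS.measurable_w s)
  -- The proximal point is taken in the metric V̂_{t-1}^{1/2}, not V̂_t^{1/2}, so that the pair is
  -- determined before sample t is drawn.
  set X : (ℕ → Ξ × EuclideanSpace ℝ (Fin d)) →
      EuclideanSpace ℝ (Fin d) × EuclideanSpace ℝ (Fin d) := fun z =>
    ((run F h β₂ β₃ μ a b x₀ q (fun s => (z s).1) (fun s => (z s).2) t).x,
      runProx (f + h) ρ F h β₂ β₃ μ a b x₀ q (fun s => (z s).1) (fun s => (z s).2) t t) with hX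
  have hXm : Measurable X :=
    (measurable_run_x hA hp hx₀ t).prodMk (measurable_runProx hA hp hμ hr hx₀ t t)
  have hXdep : ∀ z z' : ℕ → Ξ × EuclideanSpace ℝ (Fin d), (∀ s < t, z s = z' s) →
      X z = X z' := by
    intro z z' hzz
    have := run_congr (F := F) (h := h) (β₂ := β₂) (β₃ := β₃) (μ := μ) (a := a) (b := b)
      (x₀ := x₀) (q := q) (ξ := fun s => (z s).1) (ξ' := fun s => (z' s).1)
      (w := fun s => (z s).2) (w' := fun s => (z' s).2) (t := t)
      (fun s hs => by rw [hzz s hs]) (fun s hs => by rw [hzz s hs])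
    have h2 : runWeight F h β₂ β₃ μ a b x₀ q (fun s => (z s).1) (fun s => (z s).2) t =
        runWeight F h β₂ β₃ μ a b x₀ q (fun s => (z' s).1) (fun s => (z' s).2) t := by
      funext i
      rw [runWeight, this, runWeight]
    simp only [hX, runProx, h2, this]
  set V : Ω → EuclideanSpace ℝ (Fin d) × EuclideanSpace ℝ (Fin d) :=
    fun ω => X fun s => Z s ω with hV
  have hVm : Measurable V := hXm.comp hS.measurable_samples
  have hind : IndepFun V (Z t) Pr := indepFun_of_eq_of_forall_lt hZm hS.indep hXm hXdep
  have hVx : ∀ ω, (V ω).1 ∈ effDom h := fun ω => run_x_mem (hp.proxRegular_h hx₀) hx₀ t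
  have hVy : ∀ ω, (V ω).2 ∈ effDom h := fun ω => runProx_mem hp hμ hr hx₀ t t
  set G : (EuclideanSpace ℝ (Fin d) × EuclideanSpace ℝ (Fin d)) ×
      (Ξ × EuclideanSpace ℝ (Fin d)) → ℝ := fun y =>
    convexityGap r ρ p (gradEstimator F μ y.1.1 y.2.1 y.2.2) y.1.1 y.1.2 with hG
  have hGm : Measurable G :=
    measurable_convexityGap hr.continuous ((measurable_gradEstimator hp.F_measurable).comp
      (f := fun y : (EuclideanSpace ℝ (Fin d) × EuclideanSpace ℝ (Fin d)) ×
        (Ξ × EuclideanSpace ℝ (Fin d)) => (y.1.1, (y.2.1, y.2.2))) (by fun_prop))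
      (by fun_prop) (by fun_prop)
  have hint : Integrable (fun ω => G (V ω, Z t ω)) Pr := by
    refine Integrable.of_bound (hGm.comp (hVm.prodMk (hZm t))).aestronglyMeasurable
      (d * L * (√d * D) + (L * (√d * D) + ρ / 2 * (D ^ 2 * ∑ i, p i))) ?_
    filter_upwards [hS.ae_norm_eq_one] with ω hω
    exact abs_convexityGap_le hp hr hρ.le hL hD
      (norm_gradEstimator_le hp hμ (hVx ω) _ (hω t)) (hVx ω) (hVy ω)
  refine ⟨hint, ?_⟩
  obtain ⟨h1, h2⟩ := integral_comp_prodMk_of_indepFun hVm (hZm t) hind hGm hint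
  have hlaw : Pr.map (Z t) = P.prod (sphereUniform d) := hS.law t
  have h3 : ∀ ω, ∫ z, G (V ω, z) ∂Pr.map (Z t) ≤ 2 * (L * μ) := fun ω => by
    rw [hlaw]
    exact integral_convexityGap_gradEstimator_le hp hμ hρ.le hr (hVx ω) (hVy ω)
  calc ∫ ω, G (V ω, Z t ω) ∂Pr = ∫ ω, ∫ z, G (V ω, z) ∂Pr.map (Z t) ∂Pr := h2
    _ ≤ ∫ _ω, 2 * (L * μ) ∂Pr := integral_mono h1 (integrable_const _) h3
    _ = 2 * (L * μ) := by simp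

/-- The expected sum of the squared proximal displacements. -/
lemma integral_sum_wnormSq_le [NeZero d] [IsProbabilityMeasure P]
    (hA : Admissible ρ β₂ β₃ B Sb qmin qmax a₀ p q a b)
    (hp : IsProblem P F f h ρ p L D μ) (hμ : 0 < μ) (hr : IsExtension P F f h L μ r)
    (hx₀ : x₀ ∈ effDom h) (hS : IsSampling P Pr a T ξ w τ) {Δ : ℝ}
    (hΔ : moreauEnvelope (f + h) (1 / (2 * ρ)) (sqrtDiag q) x₀ ≤ (⨅ x, (f + h) x) + (Δ : EReal))
    (n : ℕ) :
    (∀ t, Integrable (fun ω =>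
      wnormSq (runWeight F h β₂ β₃ μ a b x₀ q (fun s => ξ s ω) (fun s => w s ω) (t + 1))
        ((run F h β₂ β₃ μ a b x₀ q (fun s => ξ s ω) (fun s => w s ω) t).x -
          runProx (f + h) ρ F h β₂ β₃ μ a b x₀ q (fun s => ξ s ω) (fun s => w s ω) (t + 1) t))
      Pr) ∧
    ∑ t ∈ Finset.range n, ∫ ω,
      wnormSq (runWeight F h β₂ β₃ μ a b x₀ q (fun s => ξ s ω) (fun s => w s ω) (t + 1))
        ((run F h β₂ β₃ μ a b x₀ q (fun s => ξ s ω) (fun s => w s ω) t).x -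
          runProx (f + h) ρ F h β₂ β₃ μ a b x₀ q (fun s => ξ s ω) (fun s => w s ω) (t + 1) t)
        ∂Pr ≤
      2 / (ρ ^ 2 * a₀) * (Δ + ρ * D ^ 2 * (d * (√qmax + d * L)) +
        2 * ρ * a₀ * (2 * B * (d * L) * (√d * D)) * Sb +
        n * (4 * ρ * a₀ ^ 2 * (L + B * (d * L)) ^ 2 / √qmin)) +
      6 * (D ^ 2 * (d * (√qmax + d * L))) + 4 / ρ * (n * (2 * (L * μ))) := by
  have hρ := hA.ρ_pos
  have hL := hp.lipschitzConst_nonneg hμ hx₀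
  have hD := hp.diam_nonneg hx₀
  have hw := hS.ae_norm_eq_one
  have hYi : ∀ t, Integrable (fun ω =>
      wnormSq (runWeight F h β₂ β₃ μ a b x₀ q (fun s => ξ s ω) (fun s => w s ω) (t + 1))
        ((run F h β₂ β₃ μ a b x₀ q (fun s => ξ s ω) (fun s => w s ω) t).x -
          runProx (f + h) ρ F h β₂ β₃ μ a b x₀ q (fun s => ξ s ω) (fun s => w s ω) (t + 1) t))
      Pr := by
    intro t
    refine Integrable.of_bound (C := D ^ 2 * (d * (√qmax + d * L))) ?_ ?_
    · have h1 := (measurable_runWeight (β₂ := β₂) hA hp hx₀ (t + 1)).comp hS.measurable_samples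
      have h2 := (measurable_run_x (β₂ := β₂) hA hp hx₀ t).comp hS.measurable_samples
      have h3 := (measurable_runProx (β₂ := β₂) hA hp hμ hr hx₀ (t + 1) t).comp
        hS.measurable_samples
      have h4 := h2.sub h3
      refine (Finset.measurable_sum _ fun i _ => ?_).aestronglyMeasurable
      have h5 := (measurable_pi_apply i).comp h1
      have h6 := (measurable_pi_apply i).comp ((WithLp.measurable_ofLp 2 _).comp h4)
      exact h5.mul (h6.pow_const 2)
    · filter_upwards [hw] with ω hω
      have hpos := fun i => (hA.runWeight_pos (F := F) (h := h) (μ := μ) (x₀ := x₀)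
        (ξ := fun s => ξ s ω) (w := fun s => w s ω) (t + 1) i).le
      rw [Real.norm_eq_abs, abs_of_nonneg (wnormSq_nonneg hpos _)]
      refine (wnormSq_le_of_abs_le hpos (hp.dom_bounded _
        (run_x_mem (hp.proxRegular_h hx₀) hx₀ t) _
        (runProx_mem hp hμ hr hx₀ _ _))).trans ?_
      refine mul_le_mul_of_nonneg_left ?_ (sq_nonneg D)
      refine (Finset.sum_le_sum fun i _ => hA.runWeight_le hp hμ hx₀ hL hω (t + 1) i).trans ?_
      rw [Finset.sum_const, Finset.card_univ, Fintype.card_fin, nsmul_eq_mul]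
  refine ⟨hYi, ?_⟩
  have hN := fun t => integral_convexityGap_le (t := t) hA hp hμ hr hx₀ hS
  have hNi := (integrable_finsetSum (Finset.range n) fun t _ => (hN t).1).const_mul (4 / ρ)
  set K := 2 / (ρ ^ 2 * a₀) * (Δ + ρ * D ^ 2 * (d * (√qmax + d * L)) +
        2 * ρ * a₀ * (2 * B * (d * L) * (√d * D)) * Sb +
        n * (4 * ρ * a₀ ^ 2 * (L + B * (d * L)) ^ 2 / √qmin)) +
      6 * (D ^ 2 * (d * (√qmax + d * L))) with hK
  rw [← integral_finsetSum _ fun t _ => hYi t]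
  refine (integral_mono_ae (integrable_finsetSum _ fun t _ => hYi t)
    ((integrable_const K).add hNi) ?_).trans ?_
  · filter_upwards [hw] with ω hω
    exact hA.sum_wnormSq_le hp hμ hr hx₀ hL hD hω hΔ n
  · rw [integral_add' (integrable_const K) hNi, integral_const, probReal_univ, one_smul,
      integral_const_mul, integral_finsetSum _ fun t _ => (hN t).1]
    refine add_le_add le_rfl (mul_le_mul_of_nonneg_left ?_ (by positivity))
    refine (Finset.sum_le_sum fun t _ => (hN t).2).trans ?_
    rw [Finset.sum_const, Finset.card_range, nsmul_eq_mul]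

end Expectation

/-! ### The rate -/

/-- The constant in the dimension-free rate. -/
noncomputable def rateConst (ρ α β₁ ϖ L D qmin qmax Δ : ℝ) : ℝ :=
  8 / α * (Δ + ρ * D ^ 2 * (√qmax + L) + 2 * ρ * α * (2 * (1 + β₁ / ϖ) * L * D) *
    (β₁ / ϖ / (1 - ϖ)) + 4 * ρ * α ^ 2 * ((1 + (1 + β₁ / ϖ)) * L) ^ 2 / √qmin) +
    24 * ρ ^ 2 * (D ^ 2 * (√qmax + L)) + 32 * ρ * L

/-- Pure arithmetic with δ = d, σ = √d, s = √(T+1), R = √T, Q = √qmax, c = √qmin. With a₀ = α/s and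
μ = δ/s, every term is at most a constant times δ²/s. -/
lemma rate_le {ρ α B Sb L D Q c Δ δ σ s R : ℝ} (hρ : 0 < ρ) (hα : 0 < α) (hB : 0 ≤ B)
    (hSb : 0 ≤ Sb) (hL : 0 ≤ L) (hD : 0 ≤ D) (hQ : 0 ≤ Q) (hc : 0 < c) (hΔ : 0 ≤ Δ)
    (hδ : 1 ≤ δ) (hσ : 0 ≤ σ) (hσδ : σ ≤ δ) (hs : 1 ≤ s) (hR : 0 < R) (hRs : R ≤ s) :
    4 * ρ ^ 2 * (1 / s ^ 2 * (2 / (ρ ^ 2 * (α / s)) * (Δ + ρ * D ^ 2 * (δ * (Q + δ * L)) +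
        2 * ρ * (α / s) * (2 * B * (δ * L) * (σ * D)) * Sb +
        s ^ 2 * (4 * ρ * (α / s) ^ 2 * (L + B * (δ * L)) ^ 2 / c)) +
      6 * (D ^ 2 * (δ * (Q + δ * L))) + 4 / ρ * (s ^ 2 * (2 * (L * (δ / s)))))) ≤
    (8 / α * (Δ + ρ * D ^ 2 * (Q + L) + 2 * ρ * α * (2 * B * L * D) * Sb +
        4 * ρ * α ^ 2 * ((1 + B) * L) ^ 2 / c) + 24 * ρ ^ 2 * (D ^ 2 * (Q + L)) + 32 * ρ * L) *
      (δ ^ 2 / R) := by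
  have hs0 : 0 < s := by linarith
  have hδ2 : δ ≤ δ ^ 2 := by nlinarith
  have hδ1 : 1 ≤ δ ^ 2 := hδ.trans hδ2
  have e : 4 * ρ ^ 2 * (1 / s ^ 2 * (2 / (ρ ^ 2 * (α / s)) * (Δ + ρ * D ^ 2 * (δ * (Q + δ * L)) +
        2 * ρ * (α / s) * (2 * B * (δ * L) * (σ * D)) * Sb +
        s ^ 2 * (4 * ρ * (α / s) ^ 2 * (L + B * (δ * L)) ^ 2 / c)) +
      6 * (D ^ 2 * (δ * (Q + δ * L))) + 4 / ρ * (s ^ 2 * (2 * (L * (δ / s)))))) =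
      (8 / α * (Δ + ρ * D ^ 2 * (δ * (Q + δ * L)) + 2 * ρ * (α / s) * (2 * B * L * D) * Sb * (δ * σ) +
        4 * ρ * α ^ 2 * (L + B * (δ * L)) ^ 2 / c) +
      24 * ρ ^ 2 * (D ^ 2 * (δ * (Q + δ * L))) / s + 32 * ρ * L * δ) / s := by
    field_simp
    ring
  have h1 : δ * (Q + δ * L) ≤ (Q + L) * δ ^ 2 := by
    have := mul_le_mul_of_nonneg_left hδ2 hQ
    linarith
  have h2 : α / s ≤ α := div_le_self hα.le hs
  have h3 : δ * σ ≤ δ ^ 2 := by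
    rw [sq]
    exact mul_le_mul_of_nonneg_left hσδ (by linarith)
  have h4 : (L + B * (δ * L)) ^ 2 ≤ ((1 + B) * L) ^ 2 * δ ^ 2 := by
    rw [← mul_pow]
    refine pow_le_pow_left₀ (by positivity) ?_ 2
    have := mul_le_mul_of_nonneg_left hδ hL
    linarith
  have h5 : Δ ≤ Δ * δ ^ 2 := le_mul_of_one_le_right hΔ hδ1
  have hX : 0 ≤ D ^ 2 * (δ * (Q + δ * L)) := by positivity
  have t1 : ρ * D ^ 2 * (δ * (Q + δ * L)) ≤ ρ * D ^ 2 * ((Q + L) * δ ^ 2) := by gcongr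
  have t2 : 2 * ρ * (α / s) * (2 * B * L * D) * Sb * (δ * σ) ≤
      2 * ρ * α * (2 * B * L * D) * Sb * δ ^ 2 := by gcongr
  have t3 : 4 * ρ * α ^ 2 * (L + B * (δ * L)) ^ 2 / c ≤
      4 * ρ * α ^ 2 * (((1 + B) * L) ^ 2 * δ ^ 2) / c := by gcongr
  have t4 : 24 * ρ ^ 2 * (D ^ 2 * (δ * (Q + δ * L))) / s ≤
      24 * ρ ^ 2 * (D ^ 2 * ((Q + L) * δ ^ 2)) := by
    refine (div_le_self (by positivity) hs).trans ?_
    gcongr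
  have t5 : 32 * ρ * L * δ ≤ 32 * ρ * L * δ ^ 2 := by gcongr
  rw [e]
  have t6 := mul_le_mul_of_nonneg_left (add_le_add (add_le_add (add_le_add h5 t1) t2) t3)
    (show 0 ≤ 8 / α by positivity)
  have t7 := add_le_add (add_le_add t6 t4) t5
  calc _ ≤ ((8 / α * (Δ * δ ^ 2 + ρ * D ^ 2 * ((Q + L) * δ ^ 2) +
          2 * ρ * α * (2 * B * L * D) * Sb * δ ^ 2 +
          4 * ρ * α ^ 2 * (((1 + B) * L) ^ 2 * δ ^ 2) / c) +
        24 * ρ ^ 2 * (D ^ 2 * ((Q + L) * δ ^ 2)) + 32 * ρ * L * δ ^ 2)) / s := by gcongr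
    _ ≤ ((8 / α * (Δ * δ ^ 2 + ρ * D ^ 2 * ((Q + L) * δ ^ 2) +
          2 * ρ * α * (2 * B * L * D) * Sb * δ ^ 2 +
          4 * ρ * α ^ 2 * (((1 + B) * L) ^ 2 * δ ^ 2) / c) +
        24 * ρ ^ 2 * (D ^ 2 * ((Q + L) * δ ^ 2)) + 32 * ρ * L * δ ^ 2)) / R := by gcongr
    _ = _ := by ring

/-! ### Gradients of the envelope along a run. -/

section Main

variable {d : ℕ} {Ξ : Type u} [MeasurableSpace Ξ] {P : Measure Ξ}
  {F : EuclideanSpace ℝ (Fin d) → Ξ → ℝ} {f h : EuclideanSpace ℝ (Fin d) → EReal}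
  {ρ β₂ β₃ B Sb qmin qmax a₀ : ℝ} {p q : Fin d → ℝ} {a b : ℕ → ℝ} {L D μ : ℝ}
  {x₀ : EuclideanSpace ℝ (Fin d)} {r : EuclideanSpace ℝ (Fin d) → ℝ}
  {ξ : ℕ → Ξ} {w : ℕ → EuclideanSpace ℝ (Fin d)}

lemma hasGradientAt_run (hA : Admissible ρ β₂ β₃ B Sb qmin qmax a₀ p q a b)
    (hp : IsProblem P F f h ρ p L D μ) (hμ : 0 < μ) (hr : IsExtension P F f h L μ r)
    (hx₀ : x₀ ∈ effDom h) (t : ℕ) :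
    HasGradientAt (realEnvelope (f + h) (1 / (2 * ρ))
        (sqrtDiag (run F h β₂ β₃ μ a b x₀ q ξ w (t + 1)).vhat))
      (WithLp.toLp 2 fun i => 2 * ρ * (runWeight F h β₂ β₃ μ a b x₀ q ξ w (t + 1) i *
        ((run F h β₂ β₃ μ a b x₀ q ξ w t).x i -
          runProx (f + h) ρ F h β₂ β₃ μ a b x₀ q ξ w (t + 1) t i)))
      (run F h β₂ β₃ μ a b x₀ q ξ w t).x := by
  have hρ := hA.ρ_pos
  have := (hr.proxRegular_add hp hμ.le hx₀).hasGradientAt_realEnvelope (ζ := 1 / (2 * ρ))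
    (by positivity) (by rw [one_div_two_mul_one_div]; linarith)
    (hA.runWeight_pos (F := F) (h := h) (μ := μ) (x₀ := x₀) (ξ := ξ) (w := w) (t + 1))
    (hA.le_runWeight (t + 1)) (run F h β₂ β₃ μ a b x₀ q ξ w t).x
  simp only [one_div_one_div] at this
  exact this

/-- The gradient 2ρ W (x - prox) has Euclidean norm weighted by W², one power of W more than the sum
under control; this costs a factor √qmax + dL. -/
lemma norm_sq_envelopeGrad (hA : Admissible ρ β₂ β₃ B Sb qmin qmax a₀ p q a b)
    (hp : IsProblem P F f h ρ p L D μ) (hμ : 0 < μ) (hr : IsExtension P F f h L μ r)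
    (hx₀ : x₀ ∈ effDom h) (t : ℕ) :
    ‖envelopeGrad (f + h) (1 / (2 * ρ)) (run F h β₂ β₃ μ a b x₀ q ξ w) t‖ ^ 2 =
      4 * ρ ^ 2 * wnormSq (fun i => runWeight F h β₂ β₃ μ a b x₀ q ξ w (t + 1) i ^ 2)
        ((run F h β₂ β₃ μ a b x₀ q ξ w t).x -
          runProx (f + h) ρ F h β₂ β₃ μ a b x₀ q ξ w (t + 1) t) := by
  rw [envelopeGrad, (hasGradientAt_run hA hp hμ hr hx₀ t).gradient,
    EuclideanSpace.real_norm_sq_eq, wnormSq, Finset.mul_sum]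
  refine Finset.sum_congr rfl fun i _ => ?_
  rw [PiLp.sub_apply]
  ring

/-- The scaling by W⁻¹ removes one power of W and leaves exactly the quantity summed in
`sum_wnormSq_le`, hence a dimension-free constant. -/
lemma scaledNormSq_envelopeGrad (hA : Admissible ρ β₂ β₃ B Sb qmin qmax a₀ p q a b)
    (hp : IsProblem P F f h ρ p L D μ) (hμ : 0 < μ) (hr : IsExtension P F f h L μ r)
    (hx₀ : x₀ ∈ effDom h) (t : ℕ) :
    scaledNormSq (sqrtDiag (run F h β₂ β₃ μ a b x₀ q ξ w (t + 1)).vhat)⁻¹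
        (envelopeGrad (f + h) (1 / (2 * ρ)) (run F h β₂ β₃ μ a b x₀ q ξ w) t) =
      4 * ρ ^ 2 * wnormSq (runWeight F h β₂ β₃ μ a b x₀ q ξ w (t + 1))
        ((run F h β₂ β₃ μ a b x₀ q ξ w t).x -
          runProx (f + h) ρ F h β₂ β₃ μ a b x₀ q ξ w (t + 1) t) := by
  have hpos := hA.runWeight_pos (F := F) (h := h) (μ := μ) (x₀ := x₀) (ξ := ξ) (w := w) (t + 1)
  have hinv : (sqrtDiag (run F h β₂ β₃ μ a b x₀ q ξ w (t + 1)).vhat)⁻¹ =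
      Matrix.diagonal fun i => (runWeight F h β₂ β₃ μ a b x₀ q ξ w (t + 1) i)⁻¹ := by
    refine Matrix.inv_eq_right_inv ?_
    rw [sqrtDiag, Matrix.diagonal_mul_diagonal, ← Matrix.diagonal_one]
    congr 1
    funext i
    exact mul_inv_cancel₀ (hpos i).ne'
  rw [hinv, scaledNormSq_diagonal, envelopeGrad, (hasGradientAt_run hA hp hμ hr hx₀ t).gradient,
    wnormSq, wnormSq, Finset.mul_sum]
  refine Finset.sum_congr rfl fun i _ => ?_
  rw [PiLp.sub_apply]
  have := (hpos i).ne'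
  field_simp
  ring

end Main

lemma sum_geometric_le {c ϖ : ℝ} (hc : 0 ≤ c) (hϖ : 0 ≤ ϖ) (hϖ1 : ϖ < 1) (n : ℕ) :
    ∑ t ∈ Finset.range n, c * ϖ ^ t ≤ c / (1 - ϖ) := by
  rw [← Finset.mul_sum, div_eq_mul_inv]
  refine mul_le_mul_of_nonneg_left ?_ hc
  rw [← tsum_geometric_of_lt_one hϖ hϖ1]
  exact (summable_geometric_of_lt_one hϖ hϖ1).sum_le_tsum _ fun i _ => pow_nonneg hϖ i

end Zema

theorem mainTheorem8
    (ρ α β₁ β₂ β₃ ϖ L D qmin qmax Δ : ℝ)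
    (hρ : 0 < ρ) (hα : 0 < α) (hα' : α ≤ 1 / (2 * ρ))
    (hβ₁ : 0 ≤ β₁ ∧ β₁ < 1) (hβ₂ : 0 ≤ β₂ ∧ β₂ < 1) (hβ₃ : 0 ≤ β₃ ∧ β₃ < 1)
    (hτ : β₁ / √β₂ < 1) (hϖ : 0 < ϖ ∧ ϖ < 1) (hqmin : 0 < qmin) :
    ∃ (C : ℕ → ℝ) (K : ℝ),
      ∀ (d T : ℕ) (_ : 1 ≤ d) (_ : 1 ≤ T)
        (Ξ : Type u) [MeasurableSpace Ξ] (P : Measure Ξ) [IsProbabilityMeasure P]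
        (F : EuclideanSpace ℝ (Fin d) → Ξ → ℝ) (f h : EuclideanSpace ℝ (Fin d) → EReal)
        (p q : Fin d → ℝ) (x₀ : EuclideanSpace ℝ (Fin d))
        (μ : ℝ) (_ : μ = d / √(T + 1))
        (a b₁ : ℕ → ℝ) (_ : ∀ t, a t = α / √(T + 1))
        (_ : ∀ t : ℕ, b₁ t = β₁ * ϖ ^ ((t : ℤ) - 1))
        (_ : Zema.IsProblem P F f h ρ p L D μ)
        (_ : ∀ i, qmin ≤ q i ∧ q i ≤ qmax) (_ : ∀ i, p i ≤ √(q i))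
        (_ : x₀ ∈ Zema.effDom h)
        (_ : Zema.moreauEnvelope (f + h) (1 / (2 * ρ)) (Zema.sqrtDiag q) x₀
              ≤ (⨅ x, (f + h) x) + (Δ : EReal))
        (Ω : Type v) [MeasurableSpace Ω] (Pr : Measure Ω) [IsProbabilityMeasure Pr]
        (ξ : ℕ → Ω → Ξ) (w : ℕ → Ω → EuclideanSpace ℝ (Fin d)) (τ : Ω → ℕ)
        (_ : Zema.IsSampling P Pr a T ξ w τ)
        (S : Ω → ℕ → Zema.State d)
        (_ : ∀ ω, S ω =
          Zema.run F h β₂ β₃ μ a b₁ x₀ q (fun t => ξ t ω) (fun t => w t ω)),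
        -- the envelope is differentiable at the iterates
        (∀ ω, ∀ t ≤ T, DifferentiableAt ℝ
          (Zema.realEnvelope (f + h) (1 / (2 * ρ)) (Zema.sqrtDiag (S ω (t + 1)).vhat))
          (S ω t).x) ∧
        -- the rate for the expected squared Euclidean norm
        Integrable (fun ω =>
          ‖Zema.envelopeGrad (f + h) (1 / (2 * ρ)) (S ω) (τ ω)‖ ^ 2) Pr ∧
        ∫ ω, ‖Zema.envelopeGrad (f + h) (1 / (2 * ρ)) (S ω) (τ ω)‖ ^ 2 ∂Pr
          ≤ C d * ((d : ℝ) ^ 2 / √T) ∧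
        -- the rate with a dimension-free constant, for the scaled norm
        Integrable (fun ω => Zema.scaledNormSq (Zema.sqrtDiag (S ω (τ ω + 1)).vhat)⁻¹
          (Zema.envelopeGrad (f + h) (1 / (2 * ρ)) (S ω) (τ ω))) Pr ∧
        ∫ ω, Zema.scaledNormSq (Zema.sqrtDiag (S ω (τ ω + 1)).vhat)⁻¹
          (Zema.envelopeGrad (f + h) (1 / (2 * ρ)) (S ω) (τ ω)) ∂Pr
          ≤ K * ((d : ℝ) ^ 2 / √T) := by
  -- The first constant is the dimension-free one times the bound on the weights.
  refine ⟨fun d => (√qmax + d * L) * Zema.rateConst ρ α β₁ ϖ L D qmin qmax Δ,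
    Zema.rateConst ρ α β₁ ϖ L D qmin qmax Δ, ?_⟩
  intro d T hd hT Ξ _ P _ F f h p q x₀ μ hμ a b ha hb hp hq hpq hx₀ hΔ Ω _ Pr _ ξ w τ hS S hSrun
  have : NeZero d := ⟨by omega⟩
  obtain rfl : S = fun ω => Zema.run F h β₂ β₃ μ a b x₀ q (fun t => ξ t ω) (fun t => w t ω) :=
    funext hSrun
  simp only
  have hd1 : (1 : ℝ) ≤ d := by exact_mod_cast hd
  have hT1 : (1 : ℝ) ≤ T := by exact_mod_cast hT
  set s := √((T : ℝ) + 1) with hs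
  have hs2 : s ^ 2 = (T : ℝ) + 1 := Real.sq_sqrt (by positivity)
  -- T ≥ 1 gives s ≥ √2 ≥ 4/3, which turns α ρ ≤ 1/2 into the required a₀ ρ ≤ 3/8.
  have hs1 : 4 / 3 ≤ s := Real.le_sqrt_of_sq_le (by norm_num; linarith)
  have hs0 : 0 < s := by linarith
  have hμ0 : 0 < μ := by rw [hμ]; positivity
  have hL := hp.lipschitzConst_nonneg hμ0 hx₀
  have hD := hp.diam_nonneg hx₀
  have hbt : ∀ t, b t = β₁ / ϖ * ϖ ^ t := fun t => by
    rw [hb, zpow_sub_one₀ hϖ.1.ne', zpow_natCast]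
    ring
  have hc : 0 ≤ β₁ / ϖ := div_nonneg hβ₁.1 hϖ.1.le
  have hA : Zema.Admissible ρ β₂ β₃ (1 + β₁ / ϖ) (β₁ / ϖ / (1 - ϖ)) qmin qmax (α / s) p q a b :=
    { ρ_pos := hρ
      β₂_mem := ⟨hβ₂.1, hβ₂.2.le⟩
      β₃_mem := ⟨hβ₃.1, hβ₃.2.le⟩
      a_eq := ha
      a₀_pos := by positivity
      a₀_mul_le := by
        have h1 : α * ρ ≤ 1 / 2 := by
          have := mul_le_mul_of_nonneg_right hα' hρ.le
          have e : 1 / (2 * ρ) * ρ = 1 / 2 := by field_simp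
          linarith
        rw [div_mul_eq_mul_div, div_le_iff₀ hs0]
        linarith
      b_nonneg := fun t => by
        rw [hbt]
        exact mul_nonneg hc (pow_nonneg hϖ.1.le t)
      b_succ_le := fun t => by
        have e : b (t + 1) = β₁ * ϖ ^ t := by
          rw [hb]
          push_cast
          rw [add_sub_cancel_right, zpow_natCast]
        rw [e]
        exact mul_le_one₀ hβ₁.2.le (pow_nonneg hϖ.1.le t) (pow_le_one₀ hϖ.1.le hϖ.2.le)
      b_zero_le := by simp [hbt]
      b_sum_le := fun n => by
        simp only [hbt]
        exact Zema.sum_geometric_le hc hϖ.1.le hϖ.2 n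
      qmin_pos := hqmin
      q_mem := hq
      p_le := hpq }
  obtain ⟨r, hr⟩ := hp.exists_isExtension hL
  -- The envelope is never below the infimum of ψ, which is finite: ψ is bounded below and x₀ is in
  -- its domain.
  have hΔ0 : 0 ≤ Δ := by
    have hψ := hr.proxRegular_add hp hμ0.le hx₀
    have h1 : ⨅ x, (f + h) x ≤ Zema.moreauEnvelope (f + h) (1 / (2 * ρ)) (Zema.sqrtDiag q) x₀ :=
      Zema.le_moreauEnvelope hρ.le (fun i => Real.sqrt_nonneg _) x₀
    obtain ⟨c, hc⟩ := hp.bddBelow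
    have h2 : (⨅ x, (f + h) x) ≠ ⊥ := fun hbot => by
      have : (c : EReal) ≤ ⨅ x, (f + h) x := le_iInf hc
      rw [hbot] at this
      exact EReal.coe_ne_bot c (le_bot_iff.1 this)
    have h3 : (⨅ x, (f + h) x) ≠ ⊤ := fun htop => by
      have hm : x₀ ∈ Zema.effDom (f + h) := by rwa [hr.effDom_add hp hμ0.le]
      have := (iInf_le (fun x => (f + h) x) x₀).trans_lt hm
      rw [htop] at this
      exact lt_irrefl _ this
    have h4 := h1.trans hΔ
    rw [← EReal.coe_toReal h3 h2, ← EReal.coe_add, EReal.coe_le_coe_iff] at h4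
    linarith
  set z : Ω → ℕ → Ξ × EuclideanSpace ℝ (Fin d) := fun ω t => (ξ t ω, w t ω) with hz
  have hzm : Measurable z := hS.measurable_samples
  set Y : ℕ → (ℕ → Ξ × EuclideanSpace ℝ (Fin d)) → ℝ := fun t z =>
    4 * ρ ^ 2 * Zema.wnormSq
      (Zema.runWeight F h β₂ β₃ μ a b x₀ q (fun s => (z s).1) (fun s => (z s).2) (t + 1))
      ((Zema.run F h β₂ β₃ μ a b x₀ q (fun s => (z s).1) (fun s => (z s).2) t).x -
        Zema.runProx (f + h) ρ F h β₂ β₃ μ a b x₀ q (fun s => (z s).1) (fun s => (z s).2)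
          (t + 1) t) with hY
  set Y' : ℕ → (ℕ → Ξ × EuclideanSpace ℝ (Fin d)) → ℝ := fun t z =>
    4 * ρ ^ 2 * Zema.wnormSq (fun i =>
      Zema.runWeight F h β₂ β₃ μ a b x₀ q (fun s => (z s).1) (fun s => (z s).2) (t + 1) i ^ 2)
      ((Zema.run F h β₂ β₃ μ a b x₀ q (fun s => (z s).1) (fun s => (z s).2) t).x -
        Zema.runProx (f + h) ρ F h β₂ β₃ μ a b x₀ q (fun s => (z s).1) (fun s => (z s).2)
          (t + 1) t) with hY'
  have hwm : ∀ (t : ℕ) (i : Fin d), Measurable fun z : ℕ → Ξ × EuclideanSpace ℝ (Fin d) =>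
      Zema.runWeight F h β₂ β₃ μ a b x₀ q (fun s => (z s).1) (fun s => (z s).2) t i := fun t i =>
    (measurable_pi_apply i).comp (Zema.measurable_runWeight hA hp hx₀ t)
  have hdm : ∀ (t : ℕ) (i : Fin d), Measurable fun z : ℕ → Ξ × EuclideanSpace ℝ (Fin d) =>
      ((Zema.run F h β₂ β₃ μ a b x₀ q (fun s => (z s).1) (fun s => (z s).2) t).x -
        Zema.runProx (f + h) ρ F h β₂ β₃ μ a b x₀ q (fun s => (z s).1) (fun s => (z s).2)
          (t + 1) t) i := fun t i =>
    (measurable_pi_apply i).comp ((WithLp.measurable_ofLp 2 _).comp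
      ((Zema.measurable_run_x hA hp hx₀ t).sub (Zema.measurable_runProx hA hp hμ0 hr hx₀ (t + 1) t)))
  have hYm : ∀ t, Measurable (Y t) := fun t =>
    (Finset.measurable_sum _ fun i _ => (hwm (t + 1) i).mul ((hdm t i).pow_const 2)).const_mul _
  have hYm' : ∀ t, Measurable (Y' t) := fun t =>
    (Finset.measurable_sum _ fun i _ =>
      ((hwm (t + 1) i).pow_const 2).mul ((hdm t i).pow_const 2)).const_mul _
  obtain ⟨hYi, hsum⟩ := Zema.integral_sum_wnormSq_le hA hp hμ0 hr hx₀ hS hΔ (T + 1)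
  have hYi4 : ∀ t, Integrable (fun ω => Y t (z ω)) Pr := fun t => (hYi t).const_mul (4 * ρ ^ 2)
  set Gd : ℝ := √qmax + d * L with hGd
  have hGd0 : 0 ≤ Gd := by positivity
  have hYpos : ∀ t ω, 0 ≤ Y t (z ω) := fun t ω => mul_nonneg (by positivity)
    (Zema.wnormSq_nonneg (fun i => (hA.runWeight_pos (t + 1) i).le) _)
  have hYpos' : ∀ t ω, 0 ≤ Y' t (z ω) := fun t ω => mul_nonneg (by positivity)
    (Zema.wnormSq_nonneg (fun i => sq_nonneg _) _)
  -- Only almost sure, since the weight bound needs unit directions; the null set is chosen for all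
  -- t at once so that the random index may be substituted.
  have hYY : ∀ᵐ ω ∂Pr, ∀ t, Y' t (z ω) ≤ Gd * Y t (z ω) := by
    filter_upwards [hS.ae_norm_eq_one] with ω hω t
    simp only [hY, hY', hz]
    rw [mul_left_comm]
    refine mul_le_mul_of_nonneg_left ?_ (by positivity)
    rw [Zema.wnormSq, Zema.wnormSq, Finset.mul_sum]
    refine Finset.sum_le_sum fun i _ => ?_
    rw [← mul_assoc, sq (Zema.runWeight F h β₂ β₃ μ a b x₀ q _ _ (t + 1) i)]
    refine mul_le_mul_of_nonneg_right ?_ (sq_nonneg _)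
    exact mul_le_mul_of_nonneg_right (hA.runWeight_le hp hμ0 hx₀ hL hω (t + 1) i)
      (hA.runWeight_pos (t + 1) i).le
  have hYi4' : ∀ t, Integrable (fun ω => Y' t (z ω)) Pr := fun t => by
    refine ((hYi4 t).const_mul Gd).mono' ((hYm' t).comp hzm).aestronglyMeasurable ?_
    filter_upwards [hYY] with ω hω
    rw [Real.norm_eq_abs, abs_of_nonneg (hYpos' t ω)]
    exact hω t
  -- Constant stepsizes make the output index uniform on T + 1 values.
  have hlaw : ∀ t < T + 1, Pr {ω | τ ω = t} = ENNReal.ofReal (1 / (T + 1 : ℕ)) := by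
    intro t ht
    rw [hS.law_τ t (by omega)]
    congr 1
    simp only [ha, Finset.sum_const, Finset.card_range, nsmul_eq_mul]
    have : α / s ≠ 0 := by positivity
    have hT0 : ((T + 1 : ℕ) : ℝ) ≠ 0 := by positivity
    field_simp
  obtain ⟨hi1, he1⟩ := Zema.integral_uniform_index hS.measurable_τ hzm hS.indep_τ T.succ_pos hlaw
    hYm hYi4
  obtain ⟨hi2, -⟩ := Zema.integral_uniform_index hS.measurable_τ hzm hS.indep_τ T.succ_pos hlaw
    hYm' hYi4'
  have hbound : ∫ ω, Y (τ ω) (z ω) ∂Pr ≤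
      Zema.rateConst ρ α β₁ ϖ L D qmin qmax Δ * ((d : ℝ) ^ 2 / √T) := by
    rw [he1]
    have e1 : ∀ t, ∫ ω, Y t (z ω) ∂Pr = 4 * ρ ^ 2 * _ := fun t => integral_const_mul _ _
    simp only [e1]
    rw [← Finset.mul_sum, mul_left_comm]
    have hn : ((T + 1 : ℕ) : ℝ) = s ^ 2 := by rw [hs2]; push_cast; rfl
    refine (mul_le_mul_of_nonneg_left (mul_le_mul_of_nonneg_left hsum (by positivity))
      (by positivity)).trans ?_
    rw [hn, hμ]
    have hσ : √(d : ℝ) ≤ d := Real.sqrt_le_iff.2 ⟨by positivity, by nlinarith⟩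
    exact Zema.rate_le hρ hα (by positivity) (div_nonneg hc (by linarith [hϖ.2])) hL hD
      (Real.sqrt_nonneg _) (Real.sqrt_pos.2 hqmin) hΔ0 hd1 (Real.sqrt_nonneg _) hσ (by linarith)
      (Real.sqrt_pos.2 (by linarith)) (Real.sqrt_le_sqrt (by linarith))
  have g1 : ∀ ω, ‖Zema.envelopeGrad (f + h) (1 / (2 * ρ))
      (Zema.run F h β₂ β₃ μ a b x₀ q (fun t => ξ t ω) (fun t => w t ω)) (τ ω)‖ ^ 2 =
      Y' (τ ω) (z ω) := fun ω => Zema.norm_sq_envelopeGrad hA hp hμ0 hr hx₀ (τ ω)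
  have g2 : ∀ ω, Zema.scaledNormSq (Zema.sqrtDiag (Zema.run F h β₂ β₃ μ a b x₀ q
        (fun t => ξ t ω) (fun t => w t ω) (τ ω + 1)).vhat)⁻¹
      (Zema.envelopeGrad (f + h) (1 / (2 * ρ))
        (Zema.run F h β₂ β₃ μ a b x₀ q (fun t => ξ t ω) (fun t => w t ω)) (τ ω)) =
      Y (τ ω) (z ω) := fun ω => Zema.scaledNormSq_envelopeGrad hA hp hμ0 hr hx₀ (τ ω)
  simp only [g1, g2]
  refine ⟨fun ω t _ => (Zema.hasGradientAt_run hA hp hμ0 hr hx₀ t).differentiableAt, hi2, ?_, hi1,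
    hbound⟩
  calc ∫ ω, Y' (τ ω) (z ω) ∂Pr ≤ ∫ ω, Gd * Y (τ ω) (z ω) ∂Pr := by
        refine integral_mono_ae hi2 (hi1.const_mul Gd) ?_
        filter_upwards [hYY] with ω hω
        exact hω (τ ω)
    _ = Gd * ∫ ω, Y (τ ω) (z ω) ∂Pr := integral_const_mul _ _
    _ ≤ Gd * (Zema.rateConst ρ α β₁ ϖ L D qmin qmax Δ * ((d : ℝ) ^ 2 / √T)) :=
        mul_le_mul_of_nonneg_left hbound hGd0
    _ = Gd * Zema.rateConst ρ α β₁ ϖ L D qmin qmax Δ * ((d : ℝ) ^ 2 / √T) := by ring
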